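/- Let $\eta$ be a nondegenerate symmetric bilinear form (possibly indefinite) on $\mathbb{R}^d$, written $px=\eta(p,x)$. Let $U$ be a strongly continuous unitary representation of the additive group $\mathbb{R}^d$ on a complex Hilbert space $\mathcal{H}$, with spectral resolution $E$, i.e. $U(x)=\int e^{ipx}\,dE(p)$. Let $\mathcal{D}\subset\mathcal{H}$ be the space of vectors $\Psi$ for which $x\mapsto U(x)\Psi$ is smooth. Let $|P|^2$ be the sum of the squares of the generators of $U$ and $\alpha_x(F)=U(x)FU(x)^{-1}$. Let $\mathfrak{F}$ be the set of operators $F$ on $\mathcal{H}$ whose domain contains $\mathcal{D}$ and for which there is $n\in\mathbb{N}$ such that $x\mapsto(1+|P|^2)^{-n}\alpha_x(F)(1+|P|^2)^{-n}$ (considered on $\mathcal{D}$ and extended by continuity) takes values in the bounded operators and is infinitely often differentiable in norm. For a linear map $Q$ of $\mathbb{R}^d$ with $q\,Qp=-p\,Qq$ for all $p,q$ (a skew-symmetric matrix), and $F\in\mathfrak{F}$, the warped convolution $F_Q=\int dE(p)\,\alpha_{Qp}(F)$ is the operator with domain $\mathcal{D}$ that maps $\Psi\in\mathcal{D}$ to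 the norm limit of the sums $\sum_i E(\Delta_i)\,\alpha_{Qp_i}(F)\Psi$ over countable Borel partitions $(\Delta_i)$ of $\mathbb{R}^d$ with tags $p_i$, as the mesh tends to $0$. Let $\mathcal{L}$ be a group of invertible linear maps of $\mathbb{R}^d$ that preserve $\eta$, and suppose that $U$ extends to a representation, also denoted by $U$, of $\mathcal{P}=\mathcal{L}\ltimes\mathbb{R}^d$ by bounded invertible operators on $\mathcal{H}$ (for instance a unitary one). For $\lambda\in\mathcal{P}$ put $\alpha_\lambda(F)=U(\lambda)FU(\lambda)^{-1}$. Then for every $F\in\mathfrak{F}$, every skew-symmetric $Q$ and every $\lambda=(\Lambda,x)\in\mathcal{P}$, the limits defining $F_Q$ exist on all of $\mathcal{D}$, $\alpha_\lambda(F)\in\mathfrak{F}$, the map $\Lambda Q\Lambda^{-1}$ is skew-symmetric, and $$\alpha_\lambda(F_Q)=\big(\alpha_\lambda(F)\big)_{\Lambda Q\Lambda^{-1}}$$ as operators (with equal domains). -/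

import Mathlib

namespace WarpedConvolution

open scoped ContDiff

/-- `ℝ^d`. Its Euclidean norm only serves to fix the topology, the differentiable structure and the
mesh of partitions; the inner product used in exponents and for skew symmetry is a separate
datum `η`. -/
abbrev Space (d : ℕ) : Type := EuclideanSpace ℝ (Fin d)

variable {H : Type*} [NormedAddCommGroup H] [InnerProductSpace ℂ H]

/-! ### Projection-valued measures -/

/-- Projection-valued (spectral) measures on the Borel sets of `X`. Values on non-measurable sets
are irrelevant. -/
structure PVM (X : Type*) [MeasurableSpace X] (H : Type*) [NormedAddCommGroup H]
    [InnerProductSpace ℂ H] [CompleteSpace H] where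
  /-- the projection `E(s)` -/
  proj : Set X → H →L[ℂ] H
  isStarProjection : ∀ s, MeasurableSet s → IsStarProjection (proj s)
  proj_univ : proj Set.univ = 1
  proj_inter : ∀ s t, MeasurableSet s → MeasurableSet t → proj (s ∩ t) = proj s * proj t
  hasSum_proj : ∀ s : ℕ → Set X, (∀ i, MeasurableSet (s i)) →
    Pairwise (Function.onFun Disjoint s) →
    ∀ Ψ : H, HasSum (fun i => proj (s i) Ψ) (proj (⋃ i, s i) Ψ)

namespace PVM

variable [CompleteSpace H] {X : Type*} [MeasurableSpace X]

theorem re_inner_proj (E : PVM X H) (Ψ : H) {s : Set X} (hs : MeasurableSet s) :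
    (inner ℂ Ψ (E.proj s Ψ)).re = ‖E.proj s Ψ‖ ^ 2 := by
  have h := E.isStarProjection s hs
  have h1 : E.proj s (E.proj s Ψ) = E.proj s Ψ := by
    have := congrArg (fun T : H →L[ℂ] H => T Ψ) h.isIdempotentElem.eq
    simpa using this
  have h2 : ContinuousLinearMap.adjoint (E.proj s) = E.proj s := h.isSelfAdjoint
  have h3 : inner ℂ Ψ (E.proj s Ψ) = inner ℂ (E.proj s Ψ) (E.proj s Ψ) := by
    conv_lhs => rw [← h1]
    rw [← ContinuousLinearMap.adjoint_inner_left, h2]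
  rw [h3, inner_self_eq_norm_sq_to_K]
  norm_cast

theorem proj_empty (E : PVM X H) : E.proj ∅ = 0 := by
  ext Ψ
  have h := E.hasSum_proj (fun _ => ∅) (fun _ => MeasurableSet.empty)
    (fun i j _ => by simp [Function.onFun]) Ψ
  have h2 := h.summable.tendsto_atTop_zero
  simpa using (tendsto_nhds_unique h2 tendsto_const_nhds).symm

/-- The finite positive measure `s ↦ ⟨Ψ, E(s) Ψ⟩ = ‖E(s) Ψ‖²`. -/
noncomputable def measure (E : PVM X H) (Ψ : H) : MeasureTheory.Measure X :=
  MeasureTheory.Measure.ofMeasurable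
    (fun s _ => ENNReal.ofReal (inner ℂ Ψ (E.proj s Ψ)).re)
    (by simp [E.proj_empty])
    (by
      intro f hf hd
      have h := (E.hasSum_proj f hf hd Ψ).mapL (innerSL ℂ Ψ)
      have h' := Complex.hasSum_re h
      have e : (inner ℂ Ψ (E.proj (⋃ i, f i) Ψ)).re = ∑' i, (inner ℂ Ψ (E.proj (f i) Ψ)).re := by
        simpa using h'.tsum_eq.symm
      rw [e, ENNReal.ofReal_tsum_of_nonneg]
      · intro i
        rw [E.re_inner_proj Ψ (hf i)]
        positivity
      · simpa using h'.summable)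

/-- `T = ∫ f(p) dE(p)` for a bounded operator `T`, in the weak sense
`⟨Ψ, T Ψ⟩ = ∫ f(p) ⟨Ψ, dE(p) Ψ⟩` for all `Ψ`; by polarization this determines `T`. -/
def IsIntegral (E : PVM X H) (f : X → ℂ) (T : H →L[ℂ] H) : Prop :=
  ∀ Ψ : H, MeasureTheory.Integrable f (E.measure Ψ) ∧
    inner ℂ Ψ (T Ψ) = ∫ p, f p ∂(E.measure Ψ)

end PVM

/-! ### Integrals of vector-valued functions against a projection-valued measure -/

/-- `(Δ_i, t_i)` is a countable Borel partition of `X`, with tags `t_i`, of mesh less than `δ`: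
every point of the cell `Δ_i` is closer than `δ` to `t_i`. -/
structure IsTaggedPartition {X : Type*} [PseudoMetricSpace X] [MeasurableSpace X] (δ : ℝ)
    (Δ : ℕ → Set X) (t : ℕ → X) : Prop where
  measurableSet : ∀ i, MeasurableSet (Δ i)
  disjoint : Pairwise (Function.onFun Disjoint Δ)
  iUnion_eq : ⋃ i, Δ i = Set.univ
  dist_lt : ∀ i, ∀ p ∈ Δ i, dist p (t i) < δ

theorem exists_isTaggedPartition {X : Type*} [PseudoMetricSpace X] [MeasurableSpace X]
    [OpensMeasurableSpace X] [TopologicalSpace.SeparableSpace X] [Nonempty X] {δ : ℝ}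
    (hδ : 0 < δ) : ∃ (Δ : ℕ → Set X) (t : ℕ → X), IsTaggedPartition δ Δ t := by
  refine ⟨disjointed fun i => Metric.ball (TopologicalSpace.denseSeq X i) δ,
    TopologicalSpace.denseSeq X, ?_, disjoint_disjointed _, ?_, ?_⟩
  · intro i
    exact MeasurableSet.disjointed (fun j => Metric.isOpen_ball.measurableSet) i
  · rw [iUnion_disjointed]
    refine Set.eq_univ_of_forall fun x => ?_
    obtain ⟨i, hi⟩ := (TopologicalSpace.denseRange_denseSeq X).exists_dist_lt x hδ
    exact Set.mem_iUnion.2 ⟨i, hi⟩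
  · intro i p hp
    exact disjointed_subset _ i hp

/-- `Φ = ∫ dE(p) g(p)`: the sums `∑ i, E(Δ_i) g(t_i)` over tagged partitions converge in norm, and
they tend to `Φ` as the mesh tends to zero. -/
def HasIntegral [CompleteSpace H] {X : Type*} [PseudoMetricSpace X] [MeasurableSpace X]
    (E : PVM X H) (g : X → H) (Φ : H) : Prop :=
  ∀ ε : ℝ, 0 < ε → ∃ δ : ℝ, 0 < δ ∧ ∀ (Δ : ℕ → Set X) (t : ℕ → X), IsTaggedPartition δ Δ t →
    ∃ S : H, HasSum (fun i => E.proj (Δ i) (g (t i))) S ∧ ‖S - Φ‖ < ε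

section HasIntegral

variable [CompleteSpace H] {X : Type*} [PseudoMetricSpace X] [MeasurableSpace X]

theorem IsTaggedPartition.mono {δ δ' : ℝ} {Δ : ℕ → Set X} {t : ℕ → X}
    (h : IsTaggedPartition δ Δ t) (hδ : δ ≤ δ') : IsTaggedPartition δ' Δ t :=
  ⟨h.1, h.2, h.3, fun i p hp => (h.4 i p hp).trans_le hδ⟩

theorem HasIntegral.add {E : PVM X H} {g g' : X → H} {Φ Φ' : H} (h : HasIntegral E g Φ)
    (h' : HasIntegral E g' Φ') : HasIntegral E (fun p => g p + g' p) (Φ + Φ') := by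
  intro ε hε
  obtain ⟨δ, hδ, H1⟩ := h (ε / 2) (by positivity)
  obtain ⟨δ', hδ', H2⟩ := h' (ε / 2) (by positivity)
  refine ⟨min δ δ', lt_min hδ hδ', fun Δ t hp => ?_⟩
  obtain ⟨S, hS, hn⟩ := H1 Δ t (hp.mono (min_le_left _ _))
  obtain ⟨S', hS', hn'⟩ := H2 Δ t (hp.mono (min_le_right _ _))
  refine ⟨S + S', by simpa using hS.add hS', ?_⟩
  calc ‖S + S' - (Φ + Φ')‖ = ‖(S - Φ) + (S' - Φ')‖ := by congr 1; abel
    _ ≤ ‖S - Φ‖ + ‖S' - Φ'‖ := norm_add_le _ _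
    _ < ε := by linarith

theorem HasIntegral.smul {E : PVM X H} {g : X → H} {Φ : H} (c : ℂ) (h : HasIntegral E g Φ) :
    HasIntegral E (fun p => c • g p) (c • Φ) := by
  intro ε hε
  obtain ⟨δ, hδ, H1⟩ := h (ε / (‖c‖ + 1)) (by positivity)
  refine ⟨δ, hδ, fun Δ t hp => ?_⟩
  obtain ⟨S, hS, hn⟩ := H1 Δ t hp
  refine ⟨c • S, by simpa using hS.const_smul c, ?_⟩
  rw [← smul_sub, norm_smul]
  have h1 : ‖S - Φ‖ * (‖c‖ + 1) < ε := (lt_div_iff₀ (by positivity)).1 hn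
  nlinarith [norm_nonneg (S - Φ), norm_nonneg c]

theorem HasIntegral.zero (E : PVM X H) : HasIntegral E (fun _ => 0) 0 := fun ε hε =>
  ⟨1, one_pos, fun _ _ _ => ⟨0, by simp, by simpa using hε⟩⟩

theorem HasIntegral.unique [OpensMeasurableSpace X] [TopologicalSpace.SeparableSpace X]
    [Nonempty X] {E : PVM X H} {g : X → H} {Φ Φ' : H} (h : HasIntegral E g Φ)
    (h' : HasIntegral E g Φ') : Φ = Φ' := by
  by_contra hne
  have hpos : 0 < ‖Φ - Φ'‖ := norm_pos_iff.2 (sub_ne_zero.2 hne)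
  obtain ⟨δ, hδ, H1⟩ := h (‖Φ - Φ'‖ / 2) (by positivity)
  obtain ⟨δ', hδ', H2⟩ := h' (‖Φ - Φ'‖ / 2) (by positivity)
  obtain ⟨Δ, t, hp⟩ := exists_isTaggedPartition (X := X) (lt_min hδ hδ')
  obtain ⟨S, hS, hn⟩ := H1 Δ t (hp.mono (min_le_left _ _))
  obtain ⟨S', hS', hn'⟩ := H2 Δ t (hp.mono (min_le_right _ _))
  obtain rfl := hS.unique hS'
  have : ‖Φ - Φ'‖ ≤ ‖S - Φ'‖ + ‖S - Φ‖ := by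
    have := norm_sub_le (S - Φ') (S - Φ)
    simpa using this
  linarith

end HasIntegral

/-! ### Operators and their conjugates -/

/-- `W F W⁻¹` for a (possibly unbounded) operator `F`, with its natural domain `W (dom F)`. -/
def conj (W : H ≃L[ℂ] H) (F : H →ₗ.[ℂ] H) : H →ₗ.[ℂ] H where
  domain := F.domain.comap (W.symm : H →ₗ[ℂ] H)
  toFun :=
    { toFun := fun Ψ => W (F ⟨W.symm Ψ, Ψ.2⟩)
      map_add' := fun Ψ Ψ' => by
        rw [← map_add, ← F.map_add]
        congr 2
        exact Subtype.ext (map_add W.symm (Ψ : H) (Ψ' : H))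
      map_smul' := fun c Ψ => by
        rw [RingHom.id_apply, ← map_smul, ← F.map_smul]
        congr 2
        exact Subtype.ext (map_smul W.symm c (Ψ : H)) }

open Classical in
/-- The value `F Ψ`; only used for `Ψ` in the domain of `F` (and set to `0` elsewhere). -/
noncomputable def value (F : H →ₗ.[ℂ] H) (Ψ : H) : H :=
  if h : Ψ ∈ F.domain then F ⟨Ψ, h⟩ else 0

theorem value_of_mem (F : H →ₗ.[ℂ] H) {Ψ : H} (h : Ψ ∈ F.domain) : value F Ψ = F ⟨Ψ, h⟩ :=
  dif_pos h

theorem value_add (F : H →ₗ.[ℂ] H) {Ψ Ψ' : H} (h : Ψ ∈ F.domain) (h' : Ψ' ∈ F.domain) :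
    value F (Ψ + Ψ') = value F Ψ + value F Ψ' := by
  rw [value_of_mem F h, value_of_mem F h', value_of_mem F (add_mem h h'), ← F.map_add]
  rfl

theorem value_smul (F : H →ₗ.[ℂ] H) (c : ℂ) {Ψ : H} (h : Ψ ∈ F.domain) :
    value F (c • Ψ) = c • value F Ψ := by
  rw [value_of_mem F h, value_of_mem F (Submodule.smul_mem _ c h), ← F.map_smul]
  rfl

/-! ### The translations, smooth vectors, smooth operators -/

variable {d : ℕ}

/-- The unitary `U(x)`, as a bounded invertible operator. -/
def trans (U : Multiplicative (Space d) →* (H ≃ₗᵢ[ℂ] H)) (x : Space d) : H ≃L[ℂ] H :=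
  (U (Multiplicative.ofAdd x)).toContinuousLinearEquiv

/-- The space `𝒟` of vectors `Ψ` for which `x ↦ U(x) Ψ` is smooth. -/
def smoothVectors (U : Multiplicative (Space d) →* (H ≃ₗᵢ[ℂ] H)) : Submodule ℂ H where
  carrier := {Ψ | ContDiff ℝ ∞ fun x : Space d => trans U x Ψ}
  add_mem' := fun {Ψ Ψ'} h h' => by
    simp only [Set.mem_ofPred_eq, map_add] at h h' ⊢
    exact h.add h'
  zero_mem' := by simpa using (contDiff_const : ContDiff ℝ ∞ fun _ : Space d => (0 : H))
  smul_mem' := fun c Ψ h => by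
    simp only [Set.mem_ofPred_eq, map_smul] at h ⊢
    exact h.const_smul c

/-- The integrand `p ↦ α_{Qp}(F) Ψ`. -/
noncomputable def integrand (U : Multiplicative (Space d) →* (H ≃ₗᵢ[ℂ] H))
    (Q : Space d →ₗ[ℝ] Space d) (F : H →ₗ.[ℂ] H) (Ψ : H) (p : Space d) : H :=
  value (conj (trans U (Q p)) F) Ψ

theorem integrand_add (U : Multiplicative (Space d) →* (H ≃ₗᵢ[ℂ] H))
    (Q : Space d →ₗ[ℝ] Space d) (F : H →ₗ.[ℂ] H) {Ψ Ψ' : H}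
    (h : ∀ p, Ψ ∈ (conj (trans U (Q p)) F).domain)
    (h' : ∀ p, Ψ' ∈ (conj (trans U (Q p)) F).domain) :
    integrand U Q F (Ψ + Ψ') = fun p => integrand U Q F Ψ p + integrand U Q F Ψ' p :=
  funext fun p => value_add _ (h p) (h' p)

theorem integrand_smul (U : Multiplicative (Space d) →* (H ≃ₗᵢ[ℂ] H))
    (Q : Space d →ₗ[ℝ] Space d) (F : H →ₗ.[ℂ] H) (c : ℂ) {Ψ : H}
    (h : ∀ p, Ψ ∈ (conj (trans U (Q p)) F).domain) :
    integrand U Q F (c • Ψ) = fun p => c • integrand U Q F Ψ p :=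
  funext fun p => value_smul _ c (h p)

variable [CompleteSpace H]

/-- `E` is the spectral resolution of `U` with regard to the inner product `η` on `ℝ^d`:
`U(x) = ∫ exp(i η(p, x)) dE(p)`. -/
def IsSpectralResolution (η : LinearMap.BilinForm ℝ (Space d))
    (U : Multiplicative (Space d) →* (H ≃ₗᵢ[ℂ] H)) (E : PVM (Space d) H) : Prop :=
  ∀ x : Space d, E.IsIntegral (fun p => Complex.exp (Complex.I * (η p x : ℝ)))
    (trans U x : H →L[ℂ] H)

/-- The value at the spectral point `p` of `|P|²`, the sum of the squares of the generators of `U`;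
the generator of `t ↦ U(t e_j)` has the value `η(p, e_j)` there. -/
noncomputable def generatorSq (η : LinearMap.BilinForm ℝ (Space d)) (p : Space d) : ℝ :=
  ∑ j, (η p (EuclideanSpace.single j 1)) ^ 2

/-- `F ∈ 𝔉`: the domain of `F` contains `𝒟`, and for some `n` the function
`x ↦ (1 + |P|²)⁻ⁿ α_x(F) (1 + |P|²)⁻ⁿ` takes values in the bounded operators (each value being the
continuous extension `T x` from the dense domain `𝒟`) and is smooth in operator norm. Here `R` is
`(1 + |P|²)⁻ⁿ = ∫ (1 + |p|²)⁻ⁿ dE(p)`. -/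
def IsSmoothOperator (η : LinearMap.BilinForm ℝ (Space d))
    (U : Multiplicative (Space d) →* (H ≃ₗᵢ[ℂ] H)) (E : PVM (Space d) H)
    (F : H →ₗ.[ℂ] H) : Prop :=
  smoothVectors U ≤ F.domain ∧
  ∃ (n : ℕ) (R : H →L[ℂ] H) (T : Space d → H →L[ℂ] H),
    E.IsIntegral (fun p => ((((1 + generatorSq η p) ^ n)⁻¹ : ℝ) : ℂ)) R ∧
    ContDiff ℝ ∞ T ∧
    ∀ x : Space d, ∀ Ψ ∈ smoothVectors U,
      ∃ h : R Ψ ∈ (conj (trans U x) F).domain, T x Ψ = R (conj (trans U x) F ⟨R Ψ, h⟩)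

/-! ### Warped convolutions -/

/-- The warped convolution `F_Q = ∫ dE(p) α_{Qp}(F)`: the operator `Ψ ↦ ∫ dE(p) α_{Qp}(F) Ψ`,
whose domain consists of the vectors `Ψ ∈ 𝒟` for which this integral exists. -/
noncomputable def warp (U : Multiplicative (Space d) →* (H ≃ₗᵢ[ℂ] H)) (E : PVM (Space d) H)
    (Q : Space d →ₗ[ℝ] Space d) (F : H →ₗ.[ℂ] H) : H →ₗ.[ℂ] H where
  domain :=
    { carrier := {Ψ | Ψ ∈ smoothVectors U ∧ (∀ p, Ψ ∈ (conj (trans U (Q p)) F).domain) ∧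
        ∃ Φ, HasIntegral E (integrand U Q F Ψ) Φ}
      add_mem' := by
        rintro Ψ Ψ' ⟨h1, h2, Φ, h3⟩ ⟨h1', h2', Φ', h3'⟩
        refine ⟨add_mem h1 h1', fun p => add_mem (h2 p) (h2' p), Φ + Φ', ?_⟩
        rw [integrand_add U Q F h2 h2']
        exact h3.add h3'
      zero_mem' := by
        refine ⟨zero_mem _, fun p => zero_mem _, 0, ?_⟩
        have h := integrand_smul U Q F 0 (Ψ := 0) fun p => zero_mem _
        simp only [zero_smul] at h
        rw [h]
        exact HasIntegral.zero E
      smul_mem' := by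
        rintro c Ψ ⟨h1, h2, Φ, h3⟩
        refine ⟨Submodule.smul_mem _ c h1, fun p => Submodule.smul_mem _ c (h2 p), c • Φ, ?_⟩
        rw [integrand_smul U Q F c h2]
        exact h3.smul c }
  toFun :=
    { toFun := fun Ψ => Ψ.2.2.2.choose
      map_add' := fun Ψ Ψ' => by
        have h := Ψ.2.2.2.choose_spec.add Ψ'.2.2.2.choose_spec
        rw [← integrand_add U Q F Ψ.2.2.1 Ψ'.2.2.1] at h
        exact (Ψ + Ψ').2.2.2.choose_spec.unique h
      map_smul' := fun c Ψ => by
        have h := Ψ.2.2.2.choose_spec.smul c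
        rw [← integrand_smul U Q F c Ψ.2.2.1] at h
        exact (c • Ψ).2.2.2.choose_spec.unique h }

/-- `Q` is skew symmetric with regard to `η`: `q · Qp = - p · Qq`. -/
def IsSkew (η : LinearMap.BilinForm ℝ (Space d)) (Q : Space d →ₗ[ℝ] Space d) : Prop :=
  ∀ p q, η q (Q p) = -η p (Q q)

/-! ### The group `𝒫` -/

/-- The action of a group `ℒ` of linear transformations on the additive group `ℝ^d`. -/
def linAction (L : Subgroup (Space d ≃ₗ[ℝ] Space d)) :
    L →* MulAut (Multiplicative (Space d)) where
  toFun Λ := AddEquiv.toMultiplicative (Λ : Space d ≃ₗ[ℝ] Space d).toAddEquiv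
  map_one' := rfl
  map_mul' _ _ := rfl

/-- The semidirect product `𝒫 = ℒ ⋉ ℝ^d`; for `lam = (Λ, x)`, `lam.right` is `Λ` and `lam.left`
is `x`. -/
abbrev Affine (L : Subgroup (Space d ≃ₗ[ℝ] Space d)) : Type :=
  Multiplicative (Space d) ⋊[linAction L] L

end WarpedConvolution

/-! Write R = (1+|P|²)⁻¹.

Existence. The function T(x) = Rⁿ α_x(F) Rⁿ obeys T(x+y) = U(y) T(x) U(y)⁻¹, so smoothness alone
bounds each of its derivatives by the value at 0. Every Ψ ∈ 𝒟 is RⁿΦ with Φ ∈ 𝒟, and U(y)T(x)Φ =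
T(x+y)U(y)Φ is jointly smooth in (x, y) with bounded derivatives. Arbitrary powers of R can
therefore be split off: α_x(F)Ψ = R^N k(x), with k smooth and all its derivatives bounded
(`IsSmoothOperator.exists_smoothFamily`). Divided by a power of 1+‖p‖², the function k(Qp) becomes
the inverse Fourier transform of an integrable function with finite first moment. A partition sum is
then a superposition over frequencies l of bounded functions of P, applied to fixed vectors. Passing
to the limit replaces a step function by the weighted character it samples. The scalar functional
calculus bounds the error by a multiple of mesh · (1+‖l‖), the factor R^N absorbing the weight
(`exists_hasIntegral_of_derivsLE`).

Covariance. W = U(λ) satisfies W U(x) = U(Λx) W. Uniqueness of Fourier transforms of complex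
measures turns this into W E(Λ⁻¹s) = E(s) W (`IsSpectralResolution.intertwine`), also for W that is
not unitary. Since α_λ(α_{Qp}(F)) is the translate of α_λ(F) by (ΛQΛ⁻¹)(Λp), W carries each
partition sum for F to one for α_λ(F), with cells and tags moved by Λ and the mesh changed by a
bounded factor (`HasIntegral.intertwine`).

Stability of 𝔉. The functions 1+|p|² and 1+|Λp|² are comparable, so W⁻¹RⁿW is Rⁿ times a bounded
function of P (`exists_symm_resolvent`). The same n then serves for α_λ(F). -/

namespace WarpedConvolution

open MeasureTheory Filter Topology ComplexConjugate

/-! ### Bounded functional calculus of a projection-valued measure -/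

namespace PVM

section FunctionalCalculus

variable {H : Type*} [NormedAddCommGroup H] [InnerProductSpace ℂ H] [CompleteSpace H]
  {X : Type*} [MeasurableSpace X] {E : PVM X H}

theorem measure_apply (E : PVM X H) (Ψ : H) {s : Set X} (hs : MeasurableSet s) :
    E.measure Ψ s = ENNReal.ofReal (‖E.proj s Ψ‖ ^ 2) := by
  rw [measure, Measure.ofMeasurable_apply s hs, E.re_inner_proj Ψ hs]

theorem measureReal_apply (E : PVM X H) (Ψ : H) {s : Set X} (hs : MeasurableSet s) :
    (E.measure Ψ).real s = ‖E.proj s Ψ‖ ^ 2 := by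
  rw [Measure.real, measure_apply E Ψ hs, ENNReal.toReal_ofReal (by positivity)]

instance isFiniteMeasure_measure (E : PVM X H) (Ψ : H) : IsFiniteMeasure (E.measure Ψ) :=
  ⟨by rw [measure_apply E Ψ MeasurableSet.univ]; exact ENNReal.ofReal_lt_top⟩

theorem measureReal_univ (E : PVM X H) (Ψ : H) : (E.measure Ψ).real Set.univ = ‖Ψ‖ ^ 2 := by
  rw [measureReal_apply E Ψ MeasurableSet.univ, E.proj_univ]; rfl

theorem adjoint_proj (E : PVM X H) {s : Set X} (hs : MeasurableSet s) :
    ContinuousLinearMap.adjoint (E.proj s) = E.proj s :=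
  (E.isStarProjection s hs).isSelfAdjoint

theorem inner_proj_left (E : PVM X H) {s : Set X} (hs : MeasurableSet s) (Φ Ψ : H) :
    inner ℂ (E.proj s Φ) Ψ = inner ℂ Φ (E.proj s Ψ) := by
  conv_rhs => rw [← E.adjoint_proj hs]
  rw [ContinuousLinearMap.adjoint_inner_right]

theorem proj_proj (E : PVM X H) {s t : Set X} (hs : MeasurableSet s) (ht : MeasurableSet t)
    (Ψ : H) : E.proj s (E.proj t Ψ) = E.proj (s ∩ t) Ψ := by
  rw [E.proj_inter s t hs ht]; rfl

theorem proj_proj_self (E : PVM X H) {s : Set X} (hs : MeasurableSet s) (Ψ : H) :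
    E.proj s (E.proj s Ψ) = E.proj s Ψ := by
  rw [E.proj_proj hs hs, Set.inter_self]

theorem inner_proj_self (E : PVM X H) (Ψ : H) {s : Set X} (hs : MeasurableSet s) :
    inner ℂ Ψ (E.proj s Ψ) = (‖E.proj s Ψ‖ ^ 2 : ℝ) := by
  rw [← E.proj_proj_self hs, ← E.inner_proj_left hs, E.proj_proj_self hs,
    inner_self_eq_norm_sq_to_K]
  norm_cast

theorem measure_proj (E : PVM X H) (Ψ : H) {s : Set X} (hs : MeasurableSet s) :
    E.measure (E.proj s Ψ) = (E.measure Ψ).restrict s := by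
  ext t ht
  rw [Measure.restrict_apply ht, measure_apply _ _ ht, measure_apply _ _ (ht.inter hs),
    E.proj_proj ht hs]

theorem proj_disjoint_union (E : PVM X H) {s t : Set X} (hs : MeasurableSet s)
    (ht : MeasurableSet t) (hd : Disjoint s t) (Ψ : H) :
    E.proj (s ∪ t) Ψ = E.proj s Ψ + E.proj t Ψ := by
  have h := E.hasSum_proj (fun i => if i = 0 then s else if i = 1 then t else ∅)
    (fun i => by split_ifs <;> simp [hs, ht])
    (fun i j hij => by
      simp only [Function.onFun]
      split_ifs <;> first | (subst_vars; contradiction) | simp [hd, hd.symm]) Ψ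
  have e : (⋃ i : ℕ, if i = 0 then s else if i = 1 then t else ∅) = s ∪ t := by
    ext x
    simp only [Set.mem_iUnion, Set.mem_union]
    constructor
    · rintro ⟨i, hi⟩
      split_ifs at hi <;> simp_all
    · rintro (h | h)
      · exact ⟨0, by simpa⟩
      · exact ⟨1, by simpa⟩
  rw [e] at h
  refine h.unique ?_
  have h' := hasSum_sum_of_ne_finset_zero (L := SummationFilter.unconditional ℕ) (s := Finset.range 2)
    (f := fun i : ℕ => E.proj (if i = 0 then s else if i = 1 then t else ∅) Ψ) (by
      intro i hi
      have h0 : i ≠ 0 := by rintro rfl; simp at hi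
      have h1 : i ≠ 1 := by rintro rfl; simp at hi
      simp [h0, h1, E.proj_empty])
  simpa [Finset.sum_range_succ] using h'

theorem IsIntegral.unique {f : X → ℂ} {T T' : H →L[ℂ] H} (h : E.IsIntegral f T)
    (h' : E.IsIntegral f T') : T = T' := by
  have : (T : H →ₗ[ℂ] H) = T' := by
    rw [← ext_inner_map]
    intro Ψ
    rw [← inner_conj_symm, ← inner_conj_symm _ Ψ]
    simp only [ContinuousLinearMap.coe_coe]
    rw [(h Ψ).2, (h' Ψ).2]
  ext Ψ
  exact congrArg (fun S : H →ₗ[ℂ] H => S Ψ) this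

theorem IsIntegral.add {f g : X → ℂ} {T S : H →L[ℂ] H} (h : E.IsIntegral f T)
    (h' : E.IsIntegral g S) : E.IsIntegral (fun p => f p + g p) (T + S) := fun Ψ =>
  ⟨(h Ψ).1.add (h' Ψ).1, by
    rw [integral_add (h Ψ).1 (h' Ψ).1, ← (h Ψ).2, ← (h' Ψ).2]; simp⟩

theorem IsIntegral.smul {f : X → ℂ} {T : H →L[ℂ] H} (c : ℂ) (h : E.IsIntegral f T) :
    E.IsIntegral (fun p => c * f p) (c • T) := fun Ψ =>
  ⟨(h Ψ).1.const_mul c, by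
    rw [integral_const_mul, ← (h Ψ).2]; simp⟩

theorem IsIntegral.neg {f : X → ℂ} {T : H →L[ℂ] H} (h : E.IsIntegral f T) :
    E.IsIntegral (fun p => - f p) (-T) := by
  simpa using h.smul (-1)

theorem IsIntegral.sub {f g : X → ℂ} {T S : H →L[ℂ] H} (h : E.IsIntegral f T)
    (h' : E.IsIntegral g S) : E.IsIntegral (fun p => f p - g p) (T - S) := by
  simpa [sub_eq_add_neg] using h.add h'.neg

theorem IsIntegral.adjoint {f : X → ℂ} {T : H →L[ℂ] H} (h : E.IsIntegral f T) :
    E.IsIntegral (fun p => conj (f p)) (ContinuousLinearMap.adjoint T) := fun Ψ => by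
  refine ⟨?_, ?_⟩
  · exact (Complex.conjCLE : ℂ →L[ℝ] ℂ).integrable_comp (h Ψ).1
  · rw [ContinuousLinearMap.adjoint_inner_right, ← inner_conj_symm, (h Ψ).2, integral_conj]

theorem isIntegral_indicator (E : PVM X H) {s : Set X} (hs : MeasurableSet s) :
    E.IsIntegral (s.indicator fun _ => 1) (E.proj s) := fun Ψ =>
  ⟨(integrable_const _).indicator hs, by
    rw [integral_indicator hs, setIntegral_const, E.measureReal_apply Ψ hs, E.inner_proj_self Ψ hs]
    simp⟩

theorem isIntegral_const (E : PVM X H) (c : ℂ) : E.IsIntegral (fun _ => c) (c • 1) := by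
  have h := (E.isIntegral_indicator MeasurableSet.univ).smul c
  simpa [E.proj_univ] using h

/-- The weak definition sees only quadratic forms. Evaluating the form of T at E(s)Ψ restricts the
measure to s, which gives the compression by E(s) on both sides. -/
theorem IsIntegral.indicator_aux {f : X → ℂ} {T : H →L[ℂ] H} (h : E.IsIntegral f T) {s : Set X}
    (hs : MeasurableSet s) :
    E.IsIntegral (s.indicator f) (E.proj s * T * E.proj s) := fun Ψ => by
  have h1 := h (E.proj s Ψ)
  rw [E.measure_proj Ψ hs] at h1
  refine ⟨(integrable_indicator_iff hs).2 h1.1, ?_⟩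
  rw [integral_indicator hs, ← h1.2, E.inner_proj_left hs]
  rfl

/-- Operators of the form `∫ f dE` commute with the projections of `E`. -/
theorem IsIntegral.commute_proj {f : X → ℂ} {T : H →L[ℂ] H} (h : E.IsIntegral f T) {s : Set X}
    (hs : MeasurableSet s) : T * E.proj s = E.proj s * T := by
  -- Splitting f over s and its complement exhibits T as the sum of its two diagonal blocks.
  have h1 := (h.indicator_aux hs).add (h.indicator_aux hs.compl)
  have e : (fun p => s.indicator f p + sᶜ.indicator f p) = f := by
    ext p; exact congrFun (Set.indicator_self_add_compl s f) p
  rw [e] at h1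
  have hT := h.unique h1
  have z1 : E.proj sᶜ * E.proj s = 0 := by
    rw [← E.proj_inter _ _ hs.compl hs, Set.compl_inter_self, E.proj_empty]
  have z2 : E.proj s * E.proj sᶜ = 0 := by
    rw [← E.proj_inter _ _ hs hs.compl, Set.inter_compl_self, E.proj_empty]
  have z3 : E.proj s * E.proj s = E.proj s := by
    rw [← E.proj_inter _ _ hs hs, Set.inter_self]
  have l : T * E.proj s = E.proj s * T * E.proj s := by
    conv_lhs => rw [hT]
    rw [add_mul, mul_assoc, mul_assoc, mul_assoc _ _ (E.proj s), mul_assoc _ _ (E.proj s), z1, z3]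
    simp
  have r : E.proj s * T = E.proj s * T * E.proj s := by
    conv_lhs => rw [hT]
    rw [mul_add, ← mul_assoc, ← mul_assoc, ← mul_assoc, ← mul_assoc, z2, z3]
    simp
  rw [l, r.symm]

theorem IsIntegral.indicator {f : X → ℂ} {T : H →L[ℂ] H} (h : E.IsIntegral f T) {s : Set X}
    (hs : MeasurableSet s) : E.IsIntegral (s.indicator f) (E.proj s * T) := by
  have h1 := h.indicator_aux hs
  rwa [mul_assoc, h.commute_proj hs, ← mul_assoc, ← E.proj_inter _ _ hs hs, Set.inter_self] at h1

/-- Multiplicativity is part of the statement because it passes through the induction and holds for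
every integrable f, bounded or not. It is what yields the isometry below. -/
theorem exists_isIntegral_simpleFunc (E : PVM X H) (g : SimpleFunc X ℂ) :
    ∃ S, E.IsIntegral g S ∧ ∀ f T, E.IsIntegral f T → E.IsIntegral (fun p => g p * f p) (S * T) := by
  induction g using SimpleFunc.induction with
  | const c hs =>
    rename_i s
    refine ⟨c • E.proj s, ?_, fun f T h => ?_⟩
    · convert (E.isIntegral_indicator hs).smul c using 2 with p
      by_cases hp : p ∈ s <;> simp [hp]
    · convert (h.indicator hs).smul c using 2 with p
      · by_cases hp : p ∈ s <;> simp [hp]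
      · exact smul_mul_assoc _ _ _
  | add hd h1 h2 =>
    obtain ⟨S1, h1, h1'⟩ := h1
    obtain ⟨S2, h2, h2'⟩ := h2
    refine ⟨S1 + S2, h1.add h2, fun f T h => ?_⟩
    simpa [add_mul] using (h1' f T h).add (h2' f T h)

theorem norm_sq_eq_of_mul {f : X → ℂ} {T : H →L[ℂ] H}
    (h : E.IsIntegral (fun p => conj (f p) * f p) (ContinuousLinearMap.adjoint T * T)) (Ψ : H) :
    ‖T Ψ‖ ^ 2 = ∫ p, ‖f p‖ ^ 2 ∂(E.measure Ψ) := by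
  have h1 := (h Ψ).2
  rw [mul_apply_eq_comp, ContinuousLinearMap.adjoint_inner_right,
    inner_self_eq_norm_sq_to_K] at h1
  have e : (fun p => conj (f p) * f p) = fun p => ((‖f p‖ ^ 2 : ℝ) : ℂ) := by
    ext p
    rw [Complex.conj_mul']
    push_cast; rfl
  rw [e, integral_complex_ofReal] at h1
  have h2 : ((‖T Ψ‖ ^ 2 : ℝ) : ℂ) = ((∫ p, ‖f p‖ ^ 2 ∂(E.measure Ψ) : ℝ) : ℂ) := by
    rw [← h1]; push_cast; rfl
  exact_mod_cast h2

theorem norm_sq_simpleFunc {g : SimpleFunc X ℂ} {S : H →L[ℂ] H} (h : E.IsIntegral g S) (Ψ : H) :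
    ‖S Ψ‖ ^ 2 = ∫ p, ‖g p‖ ^ 2 ∂(E.measure Ψ) := by
  refine norm_sq_eq_of_mul ?_ Ψ
  obtain ⟨S', h1, h2⟩ := E.exists_isIntegral_simpleFunc (g.map conj)
  have h3 := h2 g S h
  have h4 : S' = ContinuousLinearMap.adjoint S := h1.unique h.adjoint
  rw [← h4]
  exact h3

/-- The simple functions approximating `f`. -/
noncomputable def approx {f : X → ℂ} (hf : Measurable f) (n : ℕ) : SimpleFunc X ℂ :=
  SimpleFunc.approxOn f hf Set.univ 0 (Set.mem_univ _) n

theorem tendsto_approx {f : X → ℂ} (hf : Measurable f) (p : X) :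
    Tendsto (fun n => approx hf n p) atTop (𝓝 (f p)) :=
  SimpleFunc.tendsto_approxOn hf _ (by simp)

theorem norm_approx_le {f : X → ℂ} (hf : Measurable f) {C : ℝ} (hC : ∀ p, ‖f p‖ ≤ C) (n : ℕ)
    (p : X) : ‖approx hf n p‖ ≤ 2 * C := by
  have := SimpleFunc.norm_approxOn_zero_le hf (Set.mem_univ (0 : ℂ)) p n
  have h := hC p
  unfold approx
  linarith

/-- The isometry for simple functions makes the approximating operators strongly Cauchy. Strong
convergence is recorded as well, since products are later computed by passing to the limit in one
factor. -/
theorem exists_isIntegral_tendsto (E : PVM X H) {f : X → ℂ} (hf : Measurable f) {C : ℝ}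
    (hC : ∀ p, ‖f p‖ ≤ C) :
    ∃ T, E.IsIntegral f T ∧ ∀ S : ℕ → H →L[ℂ] H, (∀ n, E.IsIntegral (approx hf n) (S n)) →
      ∀ Ψ, Tendsto (fun n => S n Ψ) atTop (𝓝 (T Ψ)) := by
  have hex := fun n => E.exists_isIntegral_simpleFunc (approx hf n)
  choose S hS hS' using hex
  have hlim : ∀ Ψ, ∃ Φ, Tendsto (fun n => S n Ψ) atTop (𝓝 Φ) := by
    intro Ψ
    refine cauchySeq_tendsto_of_complete ?_
    have hd : Tendsto (fun n => ∫ p, ‖approx hf n p - f p‖ ^ 2 ∂(E.measure Ψ)) atTop (𝓝 0) := by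
      have := tendsto_integral_of_dominated_convergence (μ := E.measure Ψ)
        (F := fun n p => ‖approx hf n p - f p‖ ^ 2) (f := fun _ => 0) (fun _ => (3 * C) ^ 2)
        (fun n => (((approx hf n).measurable.sub hf).norm.pow_const 2).aestronglyMeasurable)
        (integrable_const _) (fun n => ae_of_all _ fun p => by
          have h1 := norm_approx_le hf hC n p
          have h2 := norm_sub_le (approx hf n p) (f p)
          have h3 := hC p
          rw [Real.norm_of_nonneg (by positivity)]
          exact pow_le_pow_left₀ (norm_nonneg _) (by linarith) 2)
        (ae_of_all _ fun p => by
          have h := ((tendsto_approx hf p).sub_const (f p)).norm.pow 2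
          simpa using h)
      simpa using this
    have hint : ∀ n, Integrable (fun p => ‖approx hf n p - f p‖ ^ 2) (E.measure Ψ) := fun n => by
      refine Integrable.of_bound
        (((approx hf n).measurable.sub hf).norm.pow_const 2).aestronglyMeasurable ((3 * C) ^ 2)
        (ae_of_all _ fun p => ?_)
      have h1 := norm_approx_le hf hC n p
      have h2 := norm_sub_le (approx hf n p) (f p)
      have h3 := hC p
      rw [Real.norm_of_nonneg (by positivity)]
      exact pow_le_pow_left₀ (norm_nonneg _) (by linarith) 2
    have hb : ∀ m n, ‖S m Ψ - S n Ψ‖ ^ 2 ≤ 2 * ∫ p, ‖approx hf m p - f p‖ ^ 2 ∂(E.measure Ψ) +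
        2 * ∫ p, ‖approx hf n p - f p‖ ^ 2 ∂(E.measure Ψ) := by
      intro m n
      have h1 := norm_sq_simpleFunc (g := approx hf m - approx hf n) ((hS m).sub (hS n)) Ψ
      rw [← integral_const_mul, ← integral_const_mul,
        ← integral_add ((hint m).const_mul 2) ((hint n).const_mul 2)]
      change ‖(S m - S n) Ψ‖ ^ 2 ≤ _
      rw [h1]
      refine integral_mono_of_nonneg (ae_of_all _ fun p => by positivity)
        (((hint m).const_mul 2).add ((hint n).const_mul 2)) (ae_of_all _ fun p => ?_)
      have h2 : ‖approx hf m p - approx hf n p‖ ≤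
          ‖approx hf m p - f p‖ + ‖approx hf n p - f p‖ := by
        have := norm_sub_le (approx hf m p - f p) (approx hf n p - f p)
        simpa using this
      simp only [SimpleFunc.coe_sub, Pi.sub_apply]
      nlinarith [norm_nonneg (approx hf m p - approx hf n p),
        sq_nonneg (‖approx hf m p - f p‖ - ‖approx hf n p - f p‖)]
    rw [Metric.cauchySeq_iff']
    intro ε hε
    obtain ⟨N, hN⟩ := (hd.eventually (gt_mem_nhds (show (0 : ℝ) < ε ^ 2 / 4 by positivity))).exists_forall_of_atTop
    refine ⟨N, fun n hn => ?_⟩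
    rw [dist_eq_norm]
    refine lt_of_pow_lt_pow_left₀ 2 hε.le ?_
    have := hb n N
    have h1 := hN n hn
    have h2 := hN N le_rfl
    linarith
  choose T0 hT0 using hlim
  -- Banach–Steinhaus: the pointwise limit of bounded operators is bounded.
  let T : H →L[ℂ] H := continuousLinearMapOfTendsto S (tendsto_pi_nhds.2 hT0)
  have hT : ∀ Ψ, T Ψ = T0 Ψ := fun Ψ => rfl
  refine ⟨T, fun Ψ => ⟨Integrable.of_bound hf.aestronglyMeasurable C (ae_of_all _ hC), ?_⟩, ?_⟩
  · have h1 : Tendsto (fun n => inner ℂ Ψ (S n Ψ)) atTop (𝓝 (inner ℂ Ψ (T Ψ))) :=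
      tendsto_const_nhds.inner (hT0 Ψ)
    have h2 : Tendsto (fun n => ∫ p, approx hf n p ∂(E.measure Ψ)) atTop
        (𝓝 (∫ p, f p ∂(E.measure Ψ))) :=
      tendsto_integral_of_dominated_convergence (fun _ => 2 * C)
        (fun n => (approx hf n).measurable.aestronglyMeasurable) (integrable_const _)
        (fun n => ae_of_all _ fun p => norm_approx_le hf hC n p)
        (ae_of_all _ fun p => tendsto_approx hf p)
    refine tendsto_nhds_unique h1 (h2.congr fun n => ?_)
    exact ((hS n Ψ).2).symm
  · intro S2 hS2 Ψ
    have : S2 = S := funext fun n => (hS2 n).unique (hS n)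
    rw [this]
    exact hT0 Ψ

/-- Only the left factor is approximated by simple functions, so only it has to be bounded; 2C|f|
dominates the integrands. -/
theorem IsIntegral.mul {f g : X → ℂ} {T S : H →L[ℂ] H} (hg : E.IsIntegral g S)
    (hf : E.IsIntegral f T) (mg : Measurable g) {C : ℝ} (hC : ∀ p, ‖g p‖ ≤ C) :
    E.IsIntegral (fun p => g p * f p) (S * T) := by
  have hex := fun n => E.exists_isIntegral_simpleFunc (approx mg n)
  choose S' hS hS' using hex
  obtain ⟨S2, h2, h2'⟩ := E.exists_isIntegral_tendsto mg hC
  obtain rfl := hg.unique h2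
  intro Ψ
  have hi : Integrable (fun p => g p * f p) (E.measure Ψ) :=
    (hf Ψ).1.bdd_mul (c := C) mg.aestronglyMeasurable (ae_of_all _ hC)
  refine ⟨hi, ?_⟩
  have h1 : Tendsto (fun n => inner ℂ Ψ (S' n (T Ψ))) atTop (𝓝 (inner ℂ Ψ (S (T Ψ)))) :=
    tendsto_const_nhds.inner (h2' S' hS (T Ψ))
  have h3 : Tendsto (fun n => ∫ p, approx mg n p * f p ∂(E.measure Ψ)) atTop
      (𝓝 (∫ p, g p * f p ∂(E.measure Ψ))) :=
    tendsto_integral_of_dominated_convergence (fun p => 2 * C * ‖f p‖)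
      (fun n => (approx mg n).measurable.aestronglyMeasurable.mul (hf Ψ).1.aestronglyMeasurable)
      ((hf Ψ).1.norm.const_mul _)
      (fun n => ae_of_all _ fun p => by
        rw [norm_mul]; exact mul_le_mul_of_nonneg_right (norm_approx_le mg hC n p) (norm_nonneg _))
      (ae_of_all _ fun p => (tendsto_approx mg p).mul_const _)
  exact tendsto_nhds_unique h1 (h3.congr fun n => ((hS' n f T hf Ψ).2).symm)

theorem IsIntegral.norm_sq {f : X → ℂ} {T : H →L[ℂ] H} (h : E.IsIntegral f T) (mf : Measurable f)
    {C : ℝ} (hC : ∀ p, ‖f p‖ ≤ C) (Ψ : H) : ‖T Ψ‖ ^ 2 = ∫ p, ‖f p‖ ^ 2 ∂(E.measure Ψ) :=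
  norm_sq_eq_of_mul (h.adjoint.mul h (Complex.continuous_conj.measurable.comp mf) (C := C)
    (by simpa using hC)) Ψ

theorem IsIntegral.norm_apply_le {f : X → ℂ} {T : H →L[ℂ] H} (h : E.IsIntegral f T)
    (mf : Measurable f) {C : ℝ} (hC0 : 0 ≤ C) (hC : ∀ p, ‖f p‖ ≤ C) (Ψ : H) :
    ‖T Ψ‖ ≤ C * ‖Ψ‖ := by
  refine le_of_sq_le_sq ?_ (by positivity)
  rw [h.norm_sq mf hC, mul_pow, ← E.measureReal_univ Ψ]
  have h1 : ∫ p, ‖f p‖ ^ 2 ∂(E.measure Ψ) ≤ ∫ _, C ^ 2 ∂(E.measure Ψ) := by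
    refine integral_mono_of_nonneg (ae_of_all _ fun p => by positivity) (integrable_const _)
      (ae_of_all _ fun p => pow_le_pow_left₀ (norm_nonneg _) (hC p) 2)
  simpa [mul_comm] using h1

theorem exists_isIntegral (E : PVM X H) {f : X → ℂ} (hf : Measurable f) {C : ℝ}
    (hC : ∀ p, ‖f p‖ ≤ C) : ∃ T, E.IsIntegral f T :=
  let ⟨T, h, _⟩ := E.exists_isIntegral_tendsto hf hC
  ⟨T, h⟩

open Classical in
/-- The operator `∫ f dE` for a bounded measurable function `f`. -/
noncomputable def op (E : PVM X H) (f : X → ℂ) : H →L[ℂ] H :=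
  if h : ∃ T, E.IsIntegral f T then h.choose else 0

theorem isIntegral_op (E : PVM X H) {f : X → ℂ} (hf : Measurable f) {C : ℝ}
    (hC : ∀ p, ‖f p‖ ≤ C) : E.IsIntegral f (E.op f) := by
  have h := E.exists_isIntegral hf hC
  rw [op, dif_pos h]
  exact h.choose_spec

theorem IsIntegral.eq_op {f : X → ℂ} {T : H →L[ℂ] H} (h : E.IsIntegral f T) : T = E.op f := by
  have h' : ∃ T, E.IsIntegral f T := ⟨T, h⟩
  rw [op, dif_pos h']
  exact h.unique h'.choose_spec

theorem op_mul_apply {f g : X → ℂ} (mf : Measurable f) (mg : Measurable g) {C D : ℝ}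
    (hf : ∀ p, ‖f p‖ ≤ C) (hg : ∀ p, ‖g p‖ ≤ D) (Ψ : H) :
    E.op (fun p => f p * g p) Ψ = E.op f (E.op g Ψ) := by
  rw [← ((E.isIntegral_op mf hf).mul (E.isIntegral_op mg hg) mf hf).eq_op]
  rfl

theorem op_comm_apply {f g : X → ℂ} (mf : Measurable f) (mg : Measurable g) {C D : ℝ}
    (hf : ∀ p, ‖f p‖ ≤ C) (hg : ∀ p, ‖g p‖ ≤ D) (Ψ : H) :
    E.op f (E.op g Ψ) = E.op g (E.op f Ψ) := by
  rw [← op_mul_apply mf mg hf hg, ← op_mul_apply mg mf hg hf]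
  simp_rw [mul_comm]

/-- Strong convergence under bounded pointwise convergence. -/
theorem tendsto_op_apply {ι : Type*} {l : Filter ι} [l.IsCountablyGenerated] {F : ι → X → ℂ}
    {f : X → ℂ} (mF : ∀ i, Measurable (F i)) (mf : Measurable f) {C : ℝ}
    (hF : ∀ i p, ‖F i p‖ ≤ C) (hf : ∀ p, ‖f p‖ ≤ C)
    (hlim : ∀ p, Tendsto (fun i => F i p) l (𝓝 (f p))) (Ψ : H) :
    Tendsto (fun i => E.op (F i) Ψ) l (𝓝 (E.op f Ψ)) := by
  have hb : ∀ i p, ‖F i p - f p‖ ≤ 2 * C := fun i p => by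
    have := norm_sub_le (F i p) (f p)
    linarith [hF i p, hf p]
  have key : ∀ i, ‖E.op (F i) Ψ - E.op f Ψ‖ ^ 2 = ∫ p, ‖F i p - f p‖ ^ 2 ∂(E.measure Ψ) := by
    intro i
    exact ((E.isIntegral_op (mF i) (hF i)).sub (E.isIntegral_op mf hf)).norm_sq
      ((mF i).sub mf) (hb i) Ψ
  have hd : Tendsto (fun i => ∫ p, ‖F i p - f p‖ ^ 2 ∂(E.measure Ψ)) l (𝓝 0) := by
    have := tendsto_integral_filter_of_dominated_convergence (μ := E.measure Ψ) (l := l)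
      (F := fun i p => ‖F i p - f p‖ ^ 2) (f := fun _ => 0) (fun _ => (2 * C) ^ 2)
      (Eventually.of_forall fun i => (((mF i).sub mf).norm.pow_const 2).aestronglyMeasurable)
      (Eventually.of_forall fun i => ae_of_all _ fun p => by
        rw [Real.norm_of_nonneg (by positivity)]
        exact pow_le_pow_left₀ (norm_nonneg _) (hb i p) 2)
      (integrable_const _)
      (ae_of_all _ fun p => by
        have h := ((hlim p).sub_const (f p)).norm.pow 2
        simpa using h)
    simpa using this
  rw [tendsto_iff_norm_sub_tendsto_zero]
  have h2 : Tendsto (fun i => ‖E.op (F i) Ψ - E.op f Ψ‖ ^ 2) l (𝓝 0) := by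
    simpa only [key] using hd
  have := h2.sqrt
  simpa using this

/-- Intertwiners of projection-valued measures intertwine the functional calculi. -/
theorem op_comp_intertwine {Y : Type*} [MeasurableSpace Y] {E' : PVM Y H} {φ : Y → X}
    (hφ : Measurable φ) (W : H →L[ℂ] H)
    (hW : ∀ s, MeasurableSet s → ∀ Ψ, W (E'.proj (φ ⁻¹' s) Ψ) = E.proj s (W Ψ))
    {f : X → ℂ} (mf : Measurable f) {C : ℝ} (hf : ∀ p, ‖f p‖ ≤ C) (Ψ : H) :
    W (E'.op (fun q => f (φ q)) Ψ) = E.op f (W Ψ) := by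
  -- On indicators the claim is the hypothesis on projections. Bounded strong limits then give
  -- general f.
  have hs : ∀ g : SimpleFunc X ℂ, W (E'.op (fun q => g (φ q)) Ψ) = E.op g (W Ψ) := by
    intro g
    have hb : ∃ S S', E.IsIntegral g S ∧ E'.IsIntegral (fun q => g (φ q)) S' ∧
        W (S' Ψ) = S (W Ψ) := by
      induction g using SimpleFunc.induction with
      | const c hs =>
        rename_i s
        refine ⟨c • E.proj s, c • E'.proj (φ ⁻¹' s), ?_, ?_, ?_⟩
        · convert (E.isIntegral_indicator hs).smul c using 2 with p
          by_cases hp : p ∈ s <;> simp [hp]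
        · convert (E'.isIntegral_indicator (hφ hs)).smul c using 2 with p
          by_cases hp : φ p ∈ s <;> simp [hp]
        · simp [hW s hs]
      | add hd h1 h2 =>
        obtain ⟨S1, S1', h1, h1', e1⟩ := h1
        obtain ⟨S2, S2', h2, h2', e2⟩ := h2
        refine ⟨S1 + S2, S1' + S2', h1.add h2, h1'.add h2', ?_⟩
        simp [e1, e2]
    obtain ⟨S, S', h, h', e⟩ := hb
    rw [← h.eq_op, ← h'.eq_op, e]
  have hC : ∀ p, ‖f p‖ ≤ 2 * C := fun p => by
    have := hf p; have := norm_nonneg (f p); linarith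
  have h1 := (W.continuous.tendsto _).comp (tendsto_op_apply (E := E') (l := atTop)
    (F := fun n q => approx mf n (φ q)) (f := fun q => f (φ q))
    (fun n => (approx mf n).measurable.comp hφ) (mf.comp hφ)
    (fun n p => norm_approx_le mf hf n _) (fun q => hC _) (fun q => tendsto_approx mf _) Ψ)
  have h2 := tendsto_op_apply (E := E) (l := atTop)
    (F := fun n q => approx mf n q) (f := f)
    (fun n => (approx mf n).measurable) mf
    (fun n p => norm_approx_le mf hf n _) hC (fun q => tendsto_approx mf _) (W Ψ)
  exact tendsto_nhds_unique h1 (h2.congr fun n => (hs _).symm)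

end FunctionalCalculus

end PVM

end WarpedConvolution

namespace WarpedConvolution

open scoped ContDiff
open MeasureTheory Filter Topology

/-! ### Smooth functions with all derivatives dominated by a weight -/

section DerivsLE

variable {V V' G G' K : Type*} [NormedAddCommGroup V] [NormedSpace ℝ V]
  [NormedAddCommGroup V'] [NormedSpace ℝ V'] [NormedAddCommGroup G] [NormedSpace ℝ G]
  [NormedAddCommGroup G'] [NormedSpace ℝ G'] [NormedAddCommGroup K] [NormedSpace ℝ K]

/-- `f` is smooth, and each of its derivatives is bounded by a multiple of `a`. -/
def DerivsLE (a : V → ℝ) (f : V → G) : Prop :=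
  ContDiff ℝ ∞ f ∧ ∀ n : ℕ, ∃ C : ℝ, ∀ x, ‖iteratedFDeriv ℝ n f x‖ ≤ C * a x

theorem DerivsLE.clm_comp {a : V → ℝ} {f : V → G} (hf : DerivsLE a f) (L : G →L[ℝ] K) :
    DerivsLE a (fun x => L (f x)) := by
  refine ⟨L.contDiff.comp hf.1, fun n => ?_⟩
  obtain ⟨C, hC⟩ := hf.2 n
  refine ⟨‖L‖ * C, fun x => ?_⟩
  rw [mul_assoc]
  exact (L.norm_iteratedFDeriv_comp_left hf.1.contDiffAt (mod_cast le_top)).trans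
    (mul_le_mul_of_nonneg_left (hC x) (norm_nonneg _))

theorem DerivsLE.comp_clm {f : V → G} (hf : DerivsLE (fun _ => 1) f) (L : V' →L[ℝ] V) :
    DerivsLE (fun _ => 1) (fun x => f (L x)) := by
  refine ⟨hf.1.comp L.contDiff, fun n => ?_⟩
  obtain ⟨C, hC⟩ := hf.2 n
  refine ⟨C * ‖L‖ ^ n, fun x => ?_⟩
  change ‖iteratedFDeriv ℝ n (f ∘ L) x‖ ≤ _
  rw [L.iteratedFDeriv_comp_right hf.1 x (mod_cast le_top)]
  refine (ContinuousMultilinearMap.norm_compContinuousLinearMap_le _ _).trans ?_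
  simp only [Finset.prod_const, Finset.card_univ, Fintype.card_fin, mul_one]
  have := hC (L x)
  gcongr
  simpa using this

theorem DerivsLE.add {a : V → ℝ} {f g : V → G} (hf : DerivsLE a f) (hg : DerivsLE a g) :
    DerivsLE a (fun x => f x + g x) := by
  refine ⟨hf.1.add hg.1, fun n => ?_⟩
  obtain ⟨C, hC⟩ := hf.2 n
  obtain ⟨D, hD⟩ := hg.2 n
  refine ⟨C + D, fun x => ?_⟩
  change ‖iteratedFDeriv ℝ n (f + g) x‖ ≤ _
  rw [iteratedFDeriv_add (hf.1.of_le (mod_cast le_top)) (hg.1.of_le (mod_cast le_top)),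
    Pi.add_apply, add_mul]
  exact (norm_add_le _ _).trans (add_le_add (hC x) (hD x))

theorem DerivsLE.zero {a : V → ℝ} : DerivsLE a (fun _ : V => (0 : G)) :=
  ⟨contDiff_const, fun n => ⟨0, fun x => by
    rw [iteratedFDeriv_fun_zero]; simp⟩⟩

theorem DerivsLE.neg {a : V → ℝ} {f : V → G} (hf : DerivsLE a f) : DerivsLE a (fun x => -f x) := by
  simpa using hf.clm_comp (-ContinuousLinearMap.id ℝ G)

theorem DerivsLE.sub {a : V → ℝ} {f g : V → G} (hf : DerivsLE a f) (hg : DerivsLE a g) :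
    DerivsLE a (fun x => f x - g x) := by
  simpa [sub_eq_add_neg] using hf.add hg.neg

theorem DerivsLE.sum {ι : Type*} {a : V → ℝ} {f : ι → V → G} (s : Finset ι)
    (hf : ∀ i ∈ s, DerivsLE a (f i)) : DerivsLE a (fun x => ∑ i ∈ s, f i x) := by
  classical
  induction s using Finset.induction_on with
  | empty => simpa using DerivsLE.zero
  | insert i s hi ih =>
    simp only [Finset.sum_insert hi]
    exact (hf i (by simp)).add (ih fun j hj => hf j (by simp [hj]))

theorem DerivsLE.fderiv_apply {a : V → ℝ} {f : V → G} (hf : DerivsLE a f) (v : V) :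
    DerivsLE a (fun x => fderiv ℝ f x v) := by
  have h : DerivsLE a (fderiv ℝ f) := by
    refine ⟨hf.1.fderiv_right (mod_cast le_top), fun n => ?_⟩
    obtain ⟨C, hC⟩ := hf.2 (n + 1)
    exact ⟨C, fun x => by rw [norm_iteratedFDeriv_fderiv]; exact hC x⟩
  exact h.clm_comp (ContinuousLinearMap.apply ℝ G v)

theorem DerivsLE.bilin {a b : V → ℝ} {f : V → G} {g : V → G'} (hf : DerivsLE a f)
    (hg : DerivsLE b g) (B : G →L[ℝ] G' →L[ℝ] K) :
    DerivsLE (fun x => a x * b x) (fun x => B (f x) (g x)) := by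
  refine ⟨B.isBoundedBilinearMap.contDiff.comp (hf.1.prodMk hg.1), fun n => ?_⟩
  choose C hC using hf.2
  choose D hD using hg.2
  refine ⟨‖B‖ * ∑ i ∈ Finset.range (n + 1), (n.choose i : ℝ) * C i * D (n - i), fun x => ?_⟩
  refine (B.norm_iteratedFDeriv_le_of_bilinear hf.1 hg.1 x (mod_cast le_top)).trans ?_
  rw [mul_assoc, Finset.sum_mul]
  refine mul_le_mul_of_nonneg_left (Finset.sum_le_sum fun i hi => ?_) (by positivity)
  calc _ = (n.choose i : ℝ) * (‖iteratedFDeriv ℝ i f x‖ * ‖iteratedFDeriv ℝ (n - i) g x‖) := by ring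
    _ ≤ (n.choose i : ℝ) * ((C i * a x) * (D (n - i) * b x)) := by
      gcongr
      · exact (norm_nonneg _).trans (hC i x)
      · exact hC i x
      · exact hD _ x
    _ = _ := by ring

theorem DerivsLE.smul {a b : V → ℝ} {f : V → ℝ} {g : V → G} (hf : DerivsLE a f)
    (hg : DerivsLE b g) : DerivsLE (fun x => a x * b x) (fun x => f x • g x) :=
  hf.bilin hg (ContinuousLinearMap.lsmul ℝ ℝ)

theorem derivsLE_clm (L : V →L[ℝ] G) : DerivsLE (fun x => 1 + ‖x‖) L := by
  refine ⟨L.contDiff, fun n => ?_⟩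
  match n with
  | 0 =>
    refine ⟨‖L‖, fun x => ?_⟩
    rw [norm_iteratedFDeriv_zero]
    exact (L.le_opNorm x).trans (by gcongr; linarith)
  | n + 1 =>
    refine ⟨‖L‖, fun x => ?_⟩
    rw [← norm_iteratedFDeriv_fderiv]
    have e : fderiv ℝ L = fun _ => L := by ext1 x; exact L.fderiv
    rw [e]
    match n with
    | 0 => rw [norm_iteratedFDeriv_zero]; nlinarith [norm_nonneg x, norm_nonneg L]
    | n + 1 =>
      rw [iteratedFDeriv_const_of_ne (by simp)]
      simp only [Pi.zero_apply, norm_zero]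
      positivity

end DerivsLE

/-! ### Inverse powers of 1 + ‖x‖² as weights -/

section Weight

variable {V : Type*} [NormedAddCommGroup V] [InnerProductSpace ℝ V]

theorem contDiff_inv_one_add_norm_sq : ContDiff ℝ ∞ fun x : V => (1 + ‖x‖ ^ 2)⁻¹ :=
  (contDiff_const.add (contDiff_norm_sq ℝ)).inv fun x => by positivity

theorem fderiv_inv_one_add_norm_sq (x : V) :
    fderiv ℝ (fun x : V => (1 + ‖x‖ ^ 2)⁻¹) x =
      (1 + ‖x‖ ^ 2)⁻¹ • ((-2 : ℝ) • ((1 + ‖x‖ ^ 2)⁻¹ • innerSL ℝ x)) := by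
  have h1 : HasFDerivAt (fun x : V => 1 + ‖x‖ ^ 2) (2 • innerSL ℝ x) x :=
    (HasStrictFDerivAt.hasFDerivAt (hasStrictFDerivAt_norm_sq x)).const_add 1
  have h2 := (hasDerivAt_inv (show (1 + ‖x‖ ^ 2 : ℝ) ≠ 0 by positivity)).comp_hasFDerivAt x h1
  rw [show (fun x : V => (1 + ‖x‖ ^ 2)⁻¹) = (fun y => y⁻¹) ∘ fun x : V => 1 + ‖x‖ ^ 2 from rfl,
    h2.fderiv]
  ext y
  simp only [smul_apply, innerSL_apply_apply, smul_eq_mul, nsmul_eq_mul]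
  push_cast
  field_simp

theorem one_add_norm_mul_inv_le {V : Type*} [NormedAddCommGroup V] (x : V) : (1 + ‖x‖ ^ 2)⁻¹ * (1 + ‖x‖) ≤ 2 := by
  rw [inv_mul_le_iff₀ (by positivity)]
  nlinarith [sq_nonneg (‖x‖ - 1), norm_nonneg x]

/-- With u = (1+‖x‖²)⁻¹ the derivative is Du = u · (-2u⟨x,·⟩). By the Leibniz rule, bounds on u up
to order n bound the second factor up to order n, and then Du by a multiple of u. -/
theorem derivsLE_inv_one_add_norm_sq :
    DerivsLE (fun x : V => (1 + ‖x‖ ^ 2)⁻¹) fun x : V => (1 + ‖x‖ ^ 2)⁻¹ := by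
  refine ⟨contDiff_inv_one_add_norm_sq, fun n => ?_⟩
  induction n using Nat.strong_induction_on with
  | _ n ih =>
    match n with
    | 0 => exact ⟨1, fun x => by
        rw [norm_iteratedFDeriv_zero, one_mul, Real.norm_of_nonneg (by positivity)]⟩
    | n + 1 =>
      -- The constraint on i sits under the existential so that constants can be chosen for all i at
      -- once.
      have ih' : ∀ i, ∃ C, i ≤ n → ∀ x : V, ‖iteratedFDeriv ℝ i (fun x : V => (1 + ‖x‖ ^ 2)⁻¹) x‖ ≤
          C * (1 + ‖x‖ ^ 2)⁻¹ := fun i => by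
        by_cases hi : i ≤ n
        · obtain ⟨C, hC⟩ := ih i (by omega)
          exact ⟨C, fun _ => hC⟩
        · exact ⟨0, fun h => absurd h hi⟩
      choose C hC using ih'
      choose D hD using (derivsLE_clm (innerSL ℝ : V →L[ℝ] V →L[ℝ] ℝ)).2
      have hsm : ContDiff ℝ ∞ fun x : V => (1 + ‖x‖ ^ 2)⁻¹ • innerSL ℝ x :=
        contDiff_inv_one_add_norm_sq.smul (innerSL ℝ).contDiff
      -- In each Leibniz term the decay of u beats the linear growth of x: u(1+‖x‖) ≤ 2.
      have hb : ∀ i, ∃ A, i ≤ n → ∀ x : V,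
          ‖iteratedFDeriv ℝ i (fun x : V => (-2 : ℝ) • ((1 + ‖x‖ ^ 2)⁻¹ • innerSL ℝ x)) x‖ ≤ A := by
        intro i
        refine ⟨2 * ∑ j ∈ Finset.range (i + 1), (i.choose j : ℝ) * (|C j| * |D (i - j)| * 2),
          fun hi x => ?_⟩
        have e := iteratedFDeriv_const_smul_apply (𝕜 := ℝ) (a := (-2 : ℝ)) (i := i)
          (f := fun x : V => (1 + ‖x‖ ^ 2)⁻¹ • innerSL ℝ x) (x := x)
          (hsm.of_le (mod_cast le_top)).contDiffAt
        change ‖iteratedFDeriv ℝ i ((-2 : ℝ) • fun x : V => (1 + ‖x‖ ^ 2)⁻¹ • innerSL ℝ x) x‖ ≤ _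
        rw [e, norm_smul, norm_neg, Real.norm_two]
        gcongr
        refine (norm_iteratedFDeriv_smul_le contDiff_inv_one_add_norm_sq
          (innerSL ℝ : V →L[ℝ] V →L[ℝ] ℝ).contDiff (N := ∞) x (mod_cast le_top)).trans ?_
        refine Finset.sum_le_sum fun j hj => ?_
        rw [mul_assoc]
        refine mul_le_mul_of_nonneg_left ?_ (Nat.cast_nonneg _)
        have hj' : j ≤ n := by simp at hj; omega
        calc _ ≤ (C j * (1 + ‖x‖ ^ 2)⁻¹) * (D (i - j) * (1 + ‖x‖)) := by
              gcongr
              · exact (norm_nonneg _).trans (hC j hj' x)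
              · exact hC j hj' x
              · exact hD _ x
          _ ≤ (|C j| * (1 + ‖x‖ ^ 2)⁻¹) * (|D (i - j)| * (1 + ‖x‖)) := by
              gcongr
              · exact (norm_nonneg _).trans (hD _ x)
              · exact le_abs_self _
              · exact le_abs_self _
          _ = |C j| * |D (i - j)| * ((1 + ‖x‖ ^ 2)⁻¹ * (1 + ‖x‖)) := by ring
          _ ≤ _ := mul_le_mul_of_nonneg_left (one_add_norm_mul_inv_le x) (by positivity)
      choose A hA using hb
      refine ⟨∑ j ∈ Finset.range (n + 1), (n.choose j : ℝ) * C j * A (n - j), fun x => ?_⟩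
      rw [← norm_iteratedFDeriv_fderiv,
        show fderiv ℝ (fun x : V => (1 + ‖x‖ ^ 2)⁻¹) = fun x => (1 + ‖x‖ ^ 2)⁻¹ •
          ((-2 : ℝ) • ((1 + ‖x‖ ^ 2)⁻¹ • innerSL ℝ x)) from funext fderiv_inv_one_add_norm_sq]
      refine (norm_iteratedFDeriv_smul_le contDiff_inv_one_add_norm_sq
          (hsm.const_smul (-2 : ℝ)) (N := ∞) x (mod_cast le_top)).trans ?_
      rw [Finset.sum_mul]
      refine Finset.sum_le_sum fun j hj => ?_
      have hj' : j ≤ n := by simp at hj; omega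
      calc _ = (n.choose j : ℝ) * (‖iteratedFDeriv ℝ j (fun x : V => (1 + ‖x‖ ^ 2)⁻¹) x‖ *
            ‖iteratedFDeriv ℝ (n - j)
              (fun x : V => (-2 : ℝ) • ((1 + ‖x‖ ^ 2)⁻¹ • innerSL ℝ x)) x‖) := mul_assoc _ _ _
        _ ≤ (n.choose j : ℝ) * ((C j * (1 + ‖x‖ ^ 2)⁻¹) * A (n - j)) := by
          gcongr
          · exact (norm_nonneg _).trans (hC j hj' x)
          · exact hC j hj' x
          · exact hA _ (by omega) x
        _ = _ := by ring

theorem derivsLE_weight (M : ℕ) :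
    DerivsLE (fun x : V => ((1 + ‖x‖ ^ 2) ^ M)⁻¹) fun x : V => ((1 + ‖x‖ ^ 2) ^ M)⁻¹ := by
  induction M with
  | zero =>
    refine ⟨by simpa using contDiff_const, fun n => ?_⟩
    match n with
    | 0 => exact ⟨1, fun x => by rw [norm_iteratedFDeriv_zero]; simp⟩
    | n + 1 => exact ⟨0, fun x => by simp [iteratedFDeriv_const_of_ne (Nat.succ_ne_zero n)]⟩
  | succ M ih =>
    convert ih.smul derivsLE_inv_one_add_norm_sq using 2 with x x
    · rw [pow_succ, mul_inv]
    · rw [pow_succ, mul_inv, smul_eq_mul]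

end Weight

end WarpedConvolution

namespace WarpedConvolution

open scoped ContDiff FourierTransform
open MeasureTheory Filter Topology

/-! ### Existence of integrals of smooth bounded functions -/

namespace PVM

variable {H : Type*} [NormedAddCommGroup H] [InnerProductSpace ℂ H] [CompleteSpace H]
  {X : Type*} [MeasurableSpace X]

theorem norm_proj_apply_le (E : PVM X H) {s : Set X} (hs : MeasurableSet s) (Ψ : H) :
    ‖E.proj s Ψ‖ ≤ ‖Ψ‖ := by
  have h := (E.isIntegral_indicator hs).norm_apply_le (measurable_const.indicator hs) zero_le_one
    (fun p => by by_cases hp : p ∈ s <;> simp [hp]) Ψ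
  simpa using h

theorem sum_proj_apply (E : PVM X H) {s : ℕ → Set X} (hs : ∀ i, MeasurableSet (s i))
    (hd : Pairwise (Function.onFun Disjoint s)) (F : Finset ℕ) (Ψ : H) :
    ∑ i ∈ F, E.proj (s i) Ψ = E.proj (⋃ i ∈ F, s i) Ψ := by
  induction F using Finset.induction_on with
  | empty => simp [E.proj_empty]
  | insert i F hi ih =>
    rw [Finset.sum_insert hi, Finset.set_biUnion_insert, ih,
      E.proj_disjoint_union (hs i) (Finset.measurableSet_biUnion F fun j _ => hs j)]
    rw [Set.disjoint_iUnion₂_right]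
    intro j hj
    exact hd (by rintro rfl; exact hi hj)

end PVM

/-! ### Partition sums of superpositions of scalar functions -/

section Superposition

variable {H : Type*} [NormedAddCommGroup H] [InnerProductSpace ℂ H] [CompleteSpace H]
  {X : Type*} [PseudoMetricSpace X] [MeasurableSpace X] {Y : Type*} [MeasurableSpace Y]

/-- Sums over a tagged partition, for a superposition `∫ c l t • φ l` of scalar functions of the
tag, written as a superposition of operators `∫ f dE`. -/
theorem IsTaggedPartition.exists_hasSum_superposition {δ : ℝ} {Δ : ℕ → Set X} {t : ℕ → X}
    (hp : IsTaggedPartition δ Δ t) (E : PVM X H) {μ : Measure Y} {ρ : X → ℂ} (mρ : Measurable ρ)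
    {D : ℝ} (hD : ∀ p, ‖ρ p‖ ≤ D) {c : Y → X → ℂ} (mc : ∀ x, Measurable fun l => c l x)
    (bc : ∀ x, ∃ A, ∀ l, ‖c l x‖ ≤ A) {A : ℝ} (hA0 : 0 ≤ A)
    (hA : ∀ l p q, dist p q < δ → ‖c l q * ρ p‖ ≤ A) {φ : Y → H} (hφ : Integrable φ μ) :
    ∃ f : Y → X → ℂ, (∀ l, Measurable (f l)) ∧ (∀ l p, ‖f l p‖ ≤ A) ∧
      (∀ l p, ∃ q, dist p q < δ ∧ f l p = c l q * ρ p) ∧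
      Integrable (fun l => E.op (f l) (φ l)) μ ∧
      HasSum (fun i => E.proj (Δ i) (E.op ρ (∫ l, c l (t i) • φ l ∂μ)))
        (∫ l, E.op (f l) (φ l) ∂μ) := by
  have hex : ∀ p, ∃ i, p ∈ Δ i := fun p => by
    have : p ∈ ⋃ i, Δ i := by rw [hp.iUnion_eq]; trivial
    simpa using this
  choose idx hidx using hex
  have idx_eq : ∀ i, ∀ p ∈ Δ i, idx p = i := fun i p hpi => by
    by_contra hne
    exact Set.disjoint_left.1 (hp.disjoint hne) (hidx p) hpi
  have midx : Measurable idx := measurable_to_countable' fun i => by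
    convert hp.measurableSet i using 1
    ext p
    exact ⟨fun h => by have := hidx p; rwa [show idx p = i from h] at this, fun h => idx_eq i p h⟩
  -- On the cell Δ i this is the constant `c l (t i)` times ρ, so one operator `E.op (f l)` encodes
  -- the whole partition sum at frequency l.
  let f : Y → X → ℂ := fun l p => c l (t (idx p)) * ρ p
  have mf : ∀ l, Measurable (f l) := fun l =>
    ((measurable_of_countable fun i => c l (t i)).comp midx).mul mρ
  have bf : ∀ l p, ‖f l p‖ ≤ A := fun l p => hA l p _ (hp.dist_lt _ p (hidx p))
  have key : ∀ l i Ψ, E.proj (Δ i) (c l (t i) • E.op ρ Ψ) = E.proj (Δ i) (E.op (f l) Ψ) := by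
    intro l i Ψ
    have h1 := ((E.isIntegral_op mρ hD).smul (c l (t i))).indicator (hp.measurableSet i)
    have h2 := (E.isIntegral_op (mf l) (bf l)).indicator (hp.measurableSet i)
    have e : (Δ i).indicator (fun p => c l (t i) * ρ p) = (Δ i).indicator (f l) := by
      ext p
      by_cases hpi : p ∈ Δ i
      · simp only [Set.indicator_of_mem hpi, f, idx_eq i p hpi]
      · simp [hpi]
    rw [e] at h1
    exact congrArg (fun T : H →L[ℂ] H => T Ψ) (h1.unique h2)
  let P : Finset ℕ → Y → H := fun s l => ∑ i ∈ s, E.proj (Δ i) (c l (t i) • E.op ρ (φ l))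
  have intc : ∀ x, Integrable (fun l => c l x • φ l) μ := fun x => by
    obtain ⟨A', hA'⟩ := bc x
    exact hφ.bdd_smul A' (mc x).aestronglyMeasurable (ae_of_all _ hA')
  have hterm : ∀ i l, E.proj (Δ i) (c l (t i) • E.op ρ (φ l)) =
      (E.proj (Δ i) * E.op ρ) (c l (t i) • φ l) := fun i l => by simp
  have intterm : ∀ i, Integrable (fun l => E.proj (Δ i) (c l (t i) • E.op ρ (φ l))) μ :=
    fun i => by
      simp_rw [hterm]
      exact (E.proj (Δ i) * E.op ρ).integrable_comp (intc _)
  have mP : ∀ s, AEStronglyMeasurable (P s) μ := fun s =>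
    (integrable_finsetSum s fun i _ => intterm i).aestronglyMeasurable
  -- Countable additivity of E at the single vector `E.op (f l) (φ l)`.
  have hlim : ∀ l, Tendsto (fun s => P s l) atTop (𝓝 (E.op (f l) (φ l))) := by
    intro l
    have h := E.hasSum_proj Δ hp.measurableSet hp.disjoint (E.op (f l) (φ l))
    rw [hp.iUnion_eq, E.proj_univ] at h
    simp only [← key] at h
    exact h
  -- A partial sum is a projection applied to that vector, so the bound does not depend on the
  -- number of cells.
  have bP : ∀ s l, ‖P s l‖ ≤ A * ‖φ l‖ := by
    intro s l
    simp only [P, key]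
    rw [E.sum_proj_apply hp.measurableSet hp.disjoint]
    exact (E.norm_proj_apply_le (Finset.measurableSet_biUnion s fun i _ => hp.measurableSet i)
      _).trans ((E.isIntegral_op (mf l) (bf l)).norm_apply_le (mf l) hA0 (bf l) _)
  have mF : AEStronglyMeasurable (fun l => E.op (f l) (φ l)) μ :=
    aestronglyMeasurable_of_tendsto_ae atTop mP (ae_of_all _ hlim)
  refine ⟨f, mf, bf, fun l p => ⟨t (idx p), hp.dist_lt _ p (hidx p), rfl⟩, ?_, ?_⟩
  · exact (hφ.norm.const_mul A).mono' mF (ae_of_all _ fun l =>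
      (E.isIntegral_op (mf l) (bf l)).norm_apply_le (mf l) hA0 (bf l) _)
  · have h := tendsto_integral_filter_of_dominated_convergence (fun l => A * ‖φ l‖)
      (Eventually.of_forall mP) (Eventually.of_forall fun s => ae_of_all _ (bP s))
      (hφ.norm.const_mul A) (ae_of_all _ hlim)
    refine Tendsto.congr (fun s => ?_) h
    simp only [P]
    rw [integral_finsetSum s fun i _ => intterm i]
    refine Finset.sum_congr rfl fun i _ => ?_
    simp_rw [hterm]
    rw [(E.proj (Δ i) * E.op ρ).integral_comp_comm (intc _)]
    rfl

/-- The limit is ∫ (c_l ρ)(P) φ(l) dμ(l). A partition of mesh δ replaces c_l ρ by a function within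
δβ(l) of it in sup norm, hence the sum errs by at most δ ∫ β‖φ‖ dμ. -/
theorem exists_hasIntegral_superposition [OpensMeasurableSpace X]
    [TopologicalSpace.SeparableSpace X] [Nonempty X] (E : PVM X H) {μ : Measure Y} {ρ : X → ℂ}
    (mρ : Measurable ρ) {D : ℝ} (hD : ∀ p, ‖ρ p‖ ≤ D) {c : Y → X → ℂ}
    (mc : ∀ x, Measurable fun l => c l x) (mc' : ∀ l, Measurable (c l))
    (bc : ∀ x, ∃ A, ∀ l, ‖c l x‖ ≤ A) {A : ℝ} (hA0 : 0 ≤ A)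
    (hA : ∀ l p q, dist p q < 1 → ‖c l q * ρ p‖ ≤ A) {β : Y → ℝ} (hβ0 : ∀ l, 0 ≤ β l)
    (hβ : ∀ l p q, ∀ δ ≤ 1, dist p q < δ → ‖c l q * ρ p - c l p * ρ p‖ ≤ δ * β l)
    {φ : Y → H} (hφ : Integrable φ μ) (hβφ : Integrable (fun l => β l * ‖φ l‖) μ) :
    ∃ Φ, HasIntegral E (fun x => E.op ρ (∫ l, c l x • φ l ∂μ)) Φ := by
  let g : Y → X → ℂ := fun l p => c l p * ρ p
  have mg : ∀ l, Measurable (g l) := fun l => (mc' l).mul mρ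
  have bg : ∀ l p, ‖g l p‖ ≤ A := fun l p => hA l p p (by simp)
  have err : ∀ {δ : ℝ}, 0 < δ → δ ≤ 1 → ∀ {Δ : ℕ → Set X} {t : ℕ → X}, IsTaggedPartition δ Δ t →
      ∃ G : Y → H, Integrable G μ ∧ (∀ l, ‖G l - E.op (g l) (φ l)‖ ≤ δ * (β l * ‖φ l‖)) ∧
      HasSum (fun i => E.proj (Δ i) (E.op ρ (∫ l, c l (t i) • φ l ∂μ))) (∫ l, G l ∂μ) := by
    intro δ hδ hδ1 Δ t hp
    obtain ⟨f, mf, bf, hf, h1, h2⟩ := hp.exists_hasSum_superposition E mρ hD mc bc hA0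
      (fun l p q hpq => hA l p q (hpq.trans_le hδ1)) hφ
    refine ⟨_, h1, fun l => ?_, h2⟩
    rw [← mul_assoc]
    refine ((E.isIntegral_op (mf l) (bf l)).sub (E.isIntegral_op (mg l) (bg l))).norm_apply_le
      ((mf l).sub (mg l)) (mul_nonneg hδ.le (hβ0 l)) (fun p => ?_) _
    obtain ⟨q, hq, e⟩ := hf l p
    rw [e]
    exact hβ l p q δ hδ1 hq
  -- Measurability in l is inherited from the partition sums of mesh 1/(n+1), which converge for
  -- each l.
  have hgint : Integrable (fun l => E.op (g l) (φ l)) μ := by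
    have hpos : ∀ n : ℕ, (0 : ℝ) < 1 / (n + 1) := fun n => by positivity
    have hle : ∀ n : ℕ, (1 : ℝ) / (n + 1) ≤ 1 := fun n => by
      rw [div_le_one (by positivity)]; linarith [Nat.cast_nonneg (α := ℝ) n]
    have : ∀ n : ℕ, ∃ G : Y → H, Integrable G μ ∧
        (∀ l, ‖G l - E.op (g l) (φ l)‖ ≤ 1 / ((n : ℝ) + 1) * (β l * ‖φ l‖)) := fun n => by
      obtain ⟨Δ, t, hp⟩ := exists_isTaggedPartition (X := X) (hpos n)
      obtain ⟨G, h1, h2, _⟩ := err (hpos n) (hle n) hp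
      exact ⟨G, h1, h2⟩
    choose G h1 h2 using this
    refine (hφ.norm.const_mul A).mono' ?_ (ae_of_all _ fun l =>
      (E.isIntegral_op (mg l) (bg l)).norm_apply_le (mg l) hA0 (bg l) _)
    refine aestronglyMeasurable_of_tendsto_ae atTop (fun n => (h1 n).aestronglyMeasurable)
      (ae_of_all _ fun l => ?_)
    rw [tendsto_iff_norm_sub_tendsto_zero]
    refine squeeze_zero (fun n => norm_nonneg _) (fun n => h2 n l) ?_
    simpa using tendsto_one_div_add_atTop_nhds_zero_nat.mul_const (β l * ‖φ l‖)
  refine ⟨∫ l, E.op (g l) (φ l) ∂μ, fun ε hε => ?_⟩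
  set I := ∫ l, β l * ‖φ l‖ ∂μ with hI
  have hI0 : 0 ≤ I := integral_nonneg fun l => mul_nonneg (hβ0 l) (norm_nonneg _)
  -- The 1 keeps the mesh in the range of the uniform bounds; I + 1 avoids division by zero.
  have hδ : 0 < min 1 (ε / (I + 1)) := lt_min one_pos (by positivity)
  refine ⟨_, hδ, fun Δ t hp => ?_⟩
  obtain ⟨G, h1, h2, h3⟩ := err hδ (min_le_left _ _) hp
  refine ⟨_, h3, ?_⟩
  rw [← integral_sub h1 hgint]
  calc _ ≤ ∫ l, min 1 (ε / (I + 1)) * (β l * ‖φ l‖) ∂μ :=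
        norm_integral_le_of_norm_le (hβφ.const_mul _) (ae_of_all _ h2)
    _ = min 1 (ε / (I + 1)) * I := integral_const_mul _ _
    _ ≤ ε / (I + 1) * I := by gcongr; exact min_le_right _ _
    _ < ε := by
      rw [div_mul_eq_mul_div, div_lt_iff₀ (by positivity)]
      nlinarith

end Superposition

/-! ### Fourier decay and existence of the vector-valued integral -/

section Fourier

variable {H : Type*} [NormedAddCommGroup H] [InnerProductSpace ℂ H]
  {V : Type*} [NormedAddCommGroup V] [InnerProductSpace ℝ V] [FiniteDimensional ℝ V]
  [MeasurableSpace V] [BorelSpace V]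

theorem DerivsLE.integrable_iteratedFDeriv {a : V → ℝ} {h : V → H} (hh : DerivsLE a h)
    (ha : Integrable a) (n : ℕ) : Integrable fun x => ‖iteratedFDeriv ℝ n h x‖ := by
  obtain ⟨C, hC⟩ := hh.2 n
  refine (ha.const_mul C).mono' ?_ (ae_of_all _ fun x => by simpa using hC x)
  exact (hh.1.continuous_iteratedFDeriv (mod_cast le_top)).norm.aestronglyMeasurable

theorem DerivsLE.integrable {a : V → ℝ} {h : V → H} (hh : DerivsLE a h) (ha : Integrable a) :
    Integrable h := by
  have := hh.integrable_iteratedFDeriv ha 0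
  simp only [norm_iteratedFDeriv_zero] at this
  exact (integrable_norm_iff hh.1.continuous.aestronglyMeasurable).1 this

theorem DerivsLE.exists_pow_mul_norm_fourier_le {a : V → ℝ} {h : V → H} (hh : DerivsLE a h)
    (ha : Integrable a) (n : ℕ) : ∃ C, ∀ w, ‖w‖ ^ n * ‖𝓕 h w‖ ≤ C := by
  refine ⟨(2 * Real.pi) ^ 0 * (2 * (0 : ℕ) + 2) ^ n *
    ∑ p ∈ Finset.range (0 + 1) ×ˢ Finset.range (n + 1),
      ∫ v, ‖v‖ ^ p.1 * ‖iteratedFDeriv ℝ p.2 h v‖, fun w => ?_⟩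
  have := Real.pow_mul_norm_iteratedFDeriv_fourier_le (K := 0) (N := ⊤) (f := h) hh.1
    (fun k m hk _ => by
      obtain rfl : k = 0 := by simpa using hk
      simpa using hh.integrable_iteratedFDeriv ha m) (k := 0) (n := n) le_rfl le_top w
  rw [norm_iteratedFDeriv_zero] at this
  exact this

/-- Integrability of all derivatives of h gives decay of its Fourier transform to every order. The
order used exceeds k by a power whose inverse is integrable. -/
theorem DerivsLE.integrable_pow_mul_norm_fourier {a : V → ℝ} {h : V → H} (hh : DerivsLE a h)
    (ha : Integrable a) (k : ℕ) : Integrable fun w => ‖w‖ ^ k * ‖𝓕 h w‖ := by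
  obtain ⟨C₁, h1⟩ := hh.exists_pow_mul_norm_fourier_le ha 0
  obtain ⟨C₂, h2⟩ := hh.exists_pow_mul_norm_fourier_le ha
    (k + (volume : Measure V).integrablePower)
  have hc : Continuous (𝓕 h) := VectorFourier.fourierIntegral_continuous
    Real.continuous_fourierChar continuous_inner (hh.integrable ha)
  exact integrable_of_le_of_pow_mul_le (fun w => by simpa using h1 w) h2 hc.aestronglyMeasurable

theorem norm_fourierChar_sub_le (x y : ℝ) :
    ‖(Real.fourierChar x : ℂ) - Real.fourierChar y‖ ≤ 2 * Real.pi * |x - y| := by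
  have e : (Real.fourierChar x : ℂ) - Real.fourierChar y =
      Real.fourierChar y * (Complex.exp (Complex.I * ((2 * Real.pi * (x - y) : ℝ) : ℂ)) - 1) := by
    rw [Real.fourierChar_apply, Real.fourierChar_apply, mul_sub, ← Complex.exp_add, mul_one]
    congr 2
    push_cast; ring
  rw [e, norm_mul, Circle.norm_coe, one_mul]
  refine Real.norm_exp_I_mul_ofReal_sub_one_le.trans ?_
  rw [Real.norm_eq_abs, abs_mul, abs_of_pos (by positivity)]

theorem one_add_norm_sq_le_of_dist {V : Type*} [NormedAddCommGroup V] {p q : V}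
    (h : dist p q < 1) : 1 + ‖q‖ ^ 2 ≤ 3 * (1 + ‖p‖ ^ 2) := by
  have h1 : ‖q‖ ≤ ‖p‖ + 1 := by
    have := norm_sub_norm_le q p
    rw [dist_comm, dist_eq_norm] at h
    linarith
  nlinarith [norm_nonneg q, norm_nonneg p, sq_nonneg (‖p‖ - 1)]

theorem abs_norm_sq_sub_le_of_dist {V : Type*} [NormedAddCommGroup V] {p q : V} {δ : ℝ}
    (hδ1 : δ ≤ 1) (h : dist p q < δ) :
    |(1 + ‖q‖ ^ 2) - (1 + ‖p‖ ^ 2)| ≤ 2 * δ * (1 + ‖p‖ ^ 2) := by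
  have h1 : |‖q‖ - ‖p‖| ≤ δ := by
    have := abs_norm_sub_norm_le q p
    rw [dist_comm, dist_eq_norm] at h
    linarith
  have hδ : 0 ≤ δ := dist_nonneg.trans h.le
  have h2 : ‖q‖ ≤ ‖p‖ + 1 := by linarith [le_abs_self (‖q‖ - ‖p‖)]
  have e : (1 + ‖q‖ ^ 2) - (1 + ‖p‖ ^ 2) = (‖q‖ - ‖p‖) * (‖q‖ + ‖p‖) := by ring
  rw [e, abs_mul, abs_of_nonneg (show 0 ≤ ‖q‖ + ‖p‖ by positivity)]
  calc _ ≤ δ * (2 * (1 + ‖p‖ ^ 2)) := by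
        gcongr
        nlinarith [sq_nonneg (‖p‖ - 1)]
    _ = _ := by ring

theorem abs_one_add_norm_sq_pow_sub_le {V : Type*} [NormedAddCommGroup V] (M : ℕ) {p q : V}
    {δ : ℝ} (hδ1 : δ ≤ 1) (h : dist p q < δ) :
    |(1 + ‖q‖ ^ 2) ^ M - (1 + ‖p‖ ^ 2) ^ M| ≤ 2 * M * 3 ^ M * δ * (1 + ‖p‖ ^ 2) ^ M := by
  have hδ : 0 ≤ δ := dist_nonneg.trans h.le
  match M with
  | 0 => simp
  | M + 1 =>
    have h1 := one_add_norm_sq_le_of_dist (h.trans_le hδ1)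
    have h2 := abs_norm_sq_sub_le_of_dist hδ1 h
    have hp : 0 ≤ 1 + ‖p‖ ^ 2 := by positivity
    have hm : max |1 + ‖q‖ ^ 2| |1 + ‖p‖ ^ 2| ≤ 3 * (1 + ‖p‖ ^ 2) := by
      rw [abs_of_nonneg (by positivity), abs_of_nonneg (by positivity)]
      exact max_le h1 (by linarith)
    calc _ ≤ |(1 + ‖q‖ ^ 2) - (1 + ‖p‖ ^ 2)| * ((M + 1 : ℕ) : ℝ) *
          max |1 + ‖q‖ ^ 2| |1 + ‖p‖ ^ 2| ^ (M + 1 - 1) := abs_pow_sub_pow_le ..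
      _ ≤ (2 * δ * (1 + ‖p‖ ^ 2)) * ((M + 1 : ℕ) : ℝ) * (3 * (1 + ‖p‖ ^ 2)) ^ M := by
        gcongr
        exact pow_le_pow_left₀ (le_max_of_le_left (abs_nonneg _)) hm M
      _ = 2 * ((M + 1 : ℕ) : ℝ) * 3 ^ M * δ * (1 + ‖p‖ ^ 2) ^ (M + 1) := by
        rw [mul_pow]; ring
      _ ≤ _ := by gcongr <;> simp

/-- Moving the argument of the character costs 2π‖l‖δ, moving that of the weight costs 2M·3^M·δ
times the weight at p, and r absorbs the weight. The growth in l is linear, so one moment of the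
Fourier transform suffices. -/
theorem norm_fourierChar_mul_pow_sub_le {V : Type*} [NormedAddCommGroup V]
    [InnerProductSpace ℝ V] {M : ℕ} {C : ℝ} {r : ℂ} (l : V) {p q : V}
    (hr : ‖r‖ * (1 + ‖p‖ ^ 2) ^ M ≤ C) {δ : ℝ} (hδ1 : δ ≤ 1) (h : dist p q < δ) :
    ‖(Real.fourierChar (inner ℝ l q) : ℂ) * ((1 + ‖q‖ ^ 2 : ℝ) : ℂ) ^ M * r -
      (Real.fourierChar (inner ℝ l p) : ℂ) * ((1 + ‖p‖ ^ 2 : ℝ) : ℂ) ^ M * r‖ ≤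
      δ * (3 ^ M * (2 * Real.pi + 2 * M) * C * (1 + ‖l‖)) := by
  have hδ : 0 ≤ δ := dist_nonneg.trans h.le
  have hC : 0 ≤ C := le_trans (by positivity) hr
  have e : (Real.fourierChar (inner ℝ l q) : ℂ) * ((1 + ‖q‖ ^ 2 : ℝ) : ℂ) ^ M * r -
      (Real.fourierChar (inner ℝ l p) : ℂ) * ((1 + ‖p‖ ^ 2 : ℝ) : ℂ) ^ M * r =
      ((Real.fourierChar (inner ℝ l q) : ℂ) - Real.fourierChar (inner ℝ l p)) *
        (((1 + ‖q‖ ^ 2) ^ M : ℝ) : ℂ) * r +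
      (Real.fourierChar (inner ℝ l p) : ℂ) *
        (((1 + ‖q‖ ^ 2) ^ M - (1 + ‖p‖ ^ 2) ^ M : ℝ) : ℂ) * r := by
    push_cast; ring
  rw [e]
  refine (norm_add_le _ _).trans ?_
  rw [norm_mul, norm_mul, norm_mul, norm_mul, Circle.norm_coe, one_mul, Complex.norm_real,
    Complex.norm_real, Real.norm_eq_abs, Real.norm_eq_abs, abs_of_nonneg (by positivity)]
  have h1 : ‖(Real.fourierChar (inner ℝ l q) : ℂ) - Real.fourierChar (inner ℝ l p)‖ ≤
      2 * Real.pi * (‖l‖ * δ) := by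
    refine (norm_fourierChar_sub_le _ _).trans ?_
    gcongr
    rw [← inner_sub_right]
    refine (abs_real_inner_le_norm _ _).trans ?_
    gcongr
    rw [← dist_eq_norm, dist_comm]
    exact h.le
  have h2 := abs_one_add_norm_sq_pow_sub_le M hδ1 h
  have h3 : (1 + ‖q‖ ^ 2) ^ M ≤ 3 ^ M * (1 + ‖p‖ ^ 2) ^ M := by
    rw [← mul_pow]
    exact pow_le_pow_left₀ (by positivity) (one_add_norm_sq_le_of_dist (h.trans_le hδ1)) M
  calc _ ≤ 2 * Real.pi * (‖l‖ * δ) * (3 ^ M * (1 + ‖p‖ ^ 2) ^ M) * ‖r‖ +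
        2 * M * 3 ^ M * δ * (1 + ‖p‖ ^ 2) ^ M * ‖r‖ := by gcongr
    _ = δ * (3 ^ M * (2 * Real.pi * ‖l‖ + 2 * M) * (‖r‖ * (1 + ‖p‖ ^ 2) ^ M)) := by ring
    _ ≤ δ * (3 ^ M * (2 * Real.pi * ‖l‖ + 2 * M) * C) := by gcongr
    _ ≤ δ * (3 ^ M * ((2 * Real.pi + 2 * M) * (1 + ‖l‖)) * C) := by
      gcongr
      have := Real.pi_pos
      nlinarith [norm_nonneg l, Nat.cast_nonneg (α := ℝ) M,
        mul_nonneg (Nat.cast_nonneg (α := ℝ) M) (norm_nonneg l)]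
    _ = _ := by ring

theorem integrable_weight {M : ℕ} (hM : Module.finrank ℝ V < 2 * M) :
    Integrable fun x : V => ((1 + ‖x‖ ^ 2) ^ M)⁻¹ := by
  have h := integrable_rpow_neg_one_add_norm_sq (E := V) (μ := volume) (r := 2 * M)
    (by exact_mod_cast hM)
  refine h.congr (ae_of_all _ fun x => ?_)
  have : (-(2 * (M : ℝ)) / 2) = -(M : ℝ) := by ring
  simp only [this]
  rw [Real.rpow_neg (by positivity), Real.rpow_natCast]

/-- `∫ dE(p) ρ(P) k(p)` exists if `k` is smooth with bounded derivatives and `ρ` decays fast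
enough. -/
theorem exists_hasIntegral_of_derivsLE [CompleteSpace H] (E : PVM V H) {ρ : V → ℂ} (mρ : Measurable ρ) {M : ℕ}
    (hM : Module.finrank ℝ V < 2 * M) {C : ℝ} (hC : ∀ p, ‖ρ p‖ * (1 + ‖p‖ ^ 2) ^ M ≤ C)
    {k : V → H} (hk : DerivsLE (fun _ => 1) k) :
    ∃ Φ, HasIntegral E (fun p => E.op ρ (k p)) Φ := by
  have hC0 : 0 ≤ C := le_trans (by positivity) (hC 0)
  have hh := (derivsLE_weight (V := V) M).smul hk
  simp only [mul_one] at hh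
  have ha := integrable_weight hM
  -- k is merely bounded; dividing by the weight makes it and all its derivatives integrable.
  set h : V → H := fun x => ((1 + ‖x‖ ^ 2) ^ M)⁻¹ • k x with hdef
  have i0 : Integrable (𝓕 h) := by
    have hc : Continuous (𝓕 h) := VectorFourier.fourierIntegral_continuous
      Real.continuous_fourierChar continuous_inner (hh.integrable ha)
    have := hh.integrable_pow_mul_norm_fourier ha 0
    simp only [pow_zero, one_mul] at this
    exact (integrable_norm_iff hc.aestronglyMeasurable).1 this
  have i1 : Integrable fun l => ‖l‖ * ‖𝓕 h l‖ := by
    simpa using hh.integrable_pow_mul_norm_fourier ha 1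
  have hinv : 𝓕⁻ (𝓕 h) = h := hh.1.continuous.fourierInv_fourier_eq (hh.integrable ha) i0
  -- The weight is put back into the scalar kernel, where ρ compensates it.
  let c : V → V → ℂ := fun l p =>
    (Real.fourierChar (inner ℝ l p) : ℂ) * ((1 + ‖p‖ ^ 2 : ℝ) : ℂ) ^ M
  have hk' : ∀ p, k p = ∫ l, c l p • 𝓕 h l := by
    intro p
    have h1 : h p = ∫ l, (Real.fourierChar (inner ℝ l p) : ℂ) • 𝓕 h l := by
      conv_lhs => rw [← hinv]
      rw [Real.fourierInv_eq]
      rfl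
    have h2 : k p = (((1 + ‖p‖ ^ 2 : ℝ) : ℂ) ^ M) • h p := by
      rw [hdef]
      simp only
      rw [← Complex.ofReal_pow, Complex.coe_smul, smul_smul, mul_inv_cancel₀ (by positivity),
        one_smul]
    rw [h2, h1, ← integral_smul]
    simp only [c, smul_smul, mul_comm]
  simp_rw [hk']
  have hcn : ∀ l p, ‖c l p‖ = (1 + ‖p‖ ^ 2) ^ M := fun l p => by
    simp only [c]
    rw [norm_mul, Circle.norm_coe, one_mul, norm_pow, Complex.norm_real,
      Real.norm_of_nonneg (by positivity)]
  refine exists_hasIntegral_superposition E mρ (D := C) (fun p => ?_) (fun x => ?_) (fun l => ?_)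
    (fun x => ⟨(1 + ‖x‖ ^ 2) ^ M, fun l => (hcn l x).le⟩) (A := 3 ^ M * C) (by positivity)
    (fun l p q hpq => ?_) (β := fun l => 3 ^ M * (2 * Real.pi + 2 * M) * C * (1 + ‖l‖))
    (fun l => by positivity)
    (fun l p q δ hδ hpq => norm_fourierChar_mul_pow_sub_le l (hC p) hδ hpq) i0 ?_
  · refine le_trans ?_ (hC p)
    exact le_mul_of_one_le_right (norm_nonneg _) (one_le_pow₀ (by nlinarith [norm_nonneg p]))
  · refine Continuous.measurable ?_
    have := Real.continuous_fourierChar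
    fun_prop
  · refine Continuous.measurable ?_
    have := Real.continuous_fourierChar
    fun_prop
  · rw [norm_mul, hcn]
    calc _ ≤ (3 ^ M * (1 + ‖p‖ ^ 2) ^ M) * ‖ρ p‖ := by
          gcongr
          rw [← mul_pow]
          exact pow_le_pow_left₀ (by positivity) (one_add_norm_sq_le_of_dist hpq) M
      _ = 3 ^ M * (‖ρ p‖ * (1 + ‖p‖ ^ 2) ^ M) := by ring
      _ ≤ _ := by gcongr; exact hC p
  · have := (i0.norm.add i1).const_mul (3 ^ M * (2 * Real.pi + 2 * M) * C)
    refine this.congr (ae_of_all _ fun l => ?_)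
    simp only [Pi.add_apply]
    ring

end Fourier

end WarpedConvolution

namespace WarpedConvolution

open MeasureTheory Filter Topology ComplexConjugate Complex

/-! ### Uniqueness of the spectral resolution -/

theorem charFun_add_measure' {V : Type*} [NormedAddCommGroup V] [InnerProductSpace ℝ V]
    [MeasurableSpace V] [BorelSpace V] (μ ν : Measure V) [IsFiniteMeasure μ]
    [IsFiniteMeasure ν] (t : V) : charFun (μ + ν) t = charFun μ t + charFun ν t := by
  have h : ∀ (κ : Measure V) [IsFiniteMeasure κ],
      Integrable (fun x : V => exp (inner ℝ x t * I)) κ := fun κ _ =>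
    Integrable.of_bound (by fun_prop) 1 (ae_of_all _ fun x => by rw [norm_exp_ofReal_mul_I])
  simp only [charFun_apply]
  exact integral_add_measure (h μ) (h ν)

/-- A complex measure, written as a combination of finite positive measures, is determined by its
Fourier transform. -/
theorem measureReal_combination_ext {V : Type*} [NormedAddCommGroup V] [InnerProductSpace ℝ V]
    [CompleteSpace V] [SecondCountableTopology V] [MeasurableSpace V] [BorelSpace V]
    {μ₀ μ₁ μ₂ μ₃ ν₀ ν₁ ν₂ ν₃ : Measure V} [IsFiniteMeasure μ₀] [IsFiniteMeasure μ₁]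
    [IsFiniteMeasure μ₂] [IsFiniteMeasure μ₃] [IsFiniteMeasure ν₀] [IsFiniteMeasure ν₁]
    [IsFiniteMeasure ν₂] [IsFiniteMeasure ν₃]
    (h : ∀ t, charFun μ₀ t + I * charFun μ₁ t - charFun μ₂ t - I * charFun μ₃ t =
      charFun ν₀ t + I * charFun ν₁ t - charFun ν₂ t - I * charFun ν₃ t) (s : Set V) :
    (μ₀.real s : ℂ) + I * μ₁.real s - μ₂.real s - I * μ₃.real s =
      ν₀.real s + I * ν₁.real s - ν₂.real s - I * ν₃.real s := by
  -- Conjugating the hypothesis at -t flips the sign of I and fixes the characteristic functions,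
  -- which separates the two signed measures μ₀ - μ₂ and μ₁ - μ₃.
  have h' : ∀ t, charFun μ₀ t - I * charFun μ₁ t - charFun μ₂ t + I * charFun μ₃ t =
      charFun ν₀ t - I * charFun ν₁ t - charFun ν₂ t + I * charFun ν₃ t := fun t => by
    have := congrArg conj (h (-t))
    simp only [charFun_neg, map_add, map_sub, map_mul, conj_conj, conj_I] at this
    linear_combination this
  -- The negative terms change sides, so that only positive measures are compared.
  have e1 : μ₀ + ν₂ = ν₀ + μ₂ := Measure.ext_of_charFun <| funext fun t => by
    rw [charFun_add_measure', charFun_add_measure']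
    linear_combination (h t + h' t) / 2
  have e2 : μ₁ + ν₃ = ν₁ + μ₃ := Measure.ext_of_charFun <| funext fun t => by
    rw [charFun_add_measure', charFun_add_measure']
    linear_combination (-I) * (h t - h' t) / 2 +
      (charFun μ₁ t - charFun μ₃ t - charFun ν₁ t + charFun ν₃ t) * I_sq
  have r1 := congrArg (fun κ : Measure V => κ.real s) e1
  have r2 := congrArg (fun κ : Measure V => κ.real s) e2
  beta_reduce at r1 r2
  rw [measureReal_add_apply, measureReal_add_apply] at r1 r2
  have r1' : (μ₀.real s : ℂ) + ν₂.real s = ν₀.real s + μ₂.real s := mod_cast r1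
  have r2' : (μ₁.real s : ℂ) + ν₃.real s = ν₁.real s + μ₃.real s := mod_cast r2
  linear_combination r1' + I * r2'

/-! ### Intertwiners of translations intertwine spectral projections -/

section Intertwine

variable {H : Type*} [NormedAddCommGroup H] [InnerProductSpace ℂ H]

theorem inner_map_polarization_right (T : H →L[ℂ] H) (a b : H) :
    4 * inner ℂ a (T b) = inner ℂ (b + a) (T (b + a)) + I * inner ℂ (b + I • a) (T (b + I • a)) -
      inner ℂ (b - a) (T (b - a)) - I * inner ℂ (b - I • a) (T (b - I • a)) := by
  simp only [map_add, map_sub, map_smul, inner_add_left, inner_add_right, inner_sub_left,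
    inner_sub_right, inner_smul_left, inner_smul_right, conj_I]
  linear_combination (2 * inner ℂ a (T b) - 2 * inner ℂ b (T a)) * I_sq

variable [CompleteSpace H] {d : ℕ}

theorem IsSpectralResolution.charFun_measure {η : LinearMap.BilinForm ℝ (Space d)}
    {U : Multiplicative (Space d) →* (H ≃ₗᵢ[ℂ] H)} {E : PVM (Space d) H}
    (hE : IsSpectralResolution η U E) {x t : Space d} (hx : ∀ p, η p x = inner ℝ p t) (Ψ : H) :
    charFun (E.measure Ψ) t = inner ℂ Ψ (trans U x Ψ) := by
  rw [charFun_apply]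
  refine Eq.trans ?_ (hE x Ψ).2.symm
  simp_rw [hx, mul_comm]

theorem IsSpectralResolution.charFun_map_measure {η : LinearMap.BilinForm ℝ (Space d)}
    {U : Multiplicative (Space d) →* (H ≃ₗᵢ[ℂ] H)} {E : PVM (Space d) H}
    (hE : IsSpectralResolution η U E) {φ : Space d → Space d} (hφ : Measurable φ)
    {x t : Space d} (hx : ∀ p, η p x = inner ℝ (φ p) t) (Ψ : H) :
    charFun ((E.measure Ψ).map φ) t = inner ℂ Ψ (trans U x Ψ) := by
  rw [charFun_apply, integral_map hφ.aemeasurable (by fun_prop)]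
  refine Eq.trans ?_ (hE x Ψ).2.symm
  simp_rw [hx, mul_comm]

/-- By nondegeneracy every Euclidean frequency has the form η(·, x), so the matrix elements of U
give the full characteristic functions of the spectral measures. -/
theorem exists_bilin_eq_inner {η : LinearMap.BilinForm ℝ (Space d)} (hη_symm : η.IsSymm)
    (hη : η.Nondegenerate) (t : Space d) : ∃ x, ∀ p, η p x = inner ℝ p t := by
  refine ⟨(η.toDual hη).symm (innerSL ℝ t : Space d →L[ℝ] ℝ), fun p => ?_⟩
  rw [← hη_symm.eq, ← LinearMap.BilinForm.toDual_def hη,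
    LinearEquiv.apply_symm_apply]
  exact real_inner_comm p t

/-- An operator that intertwines `U(x)` and `U(Λx)` intertwines the spectral projections. -/
theorem IsSpectralResolution.intertwine {η : LinearMap.BilinForm ℝ (Space d)}
    (hη_symm : η.IsSymm) (hη : η.Nondegenerate)
    {U : Multiplicative (Space d) →* (H ≃ₗᵢ[ℂ] H)} {E : PVM (Space d) H}
    (hE : IsSpectralResolution η U E) {Λ : Space d ≃ₗ[ℝ] Space d}
    (hΛ : ∀ x y, η (Λ x) (Λ y) = η x y) {W : H →L[ℂ] H}
    (hW : ∀ x Ψ, W (trans U x Ψ) = trans U (Λ x) (W Ψ)) {s : Set (Space d)}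
    (hs : MeasurableSet s) (Ψ : H) : W (E.proj (Λ ⁻¹' s) Ψ) = E.proj s (W Ψ) := by
  have mΛ : Measurable Λ := Λ.toContinuousLinearEquiv.continuous.measurable
  refine ext_inner_left ℂ fun Φ => ?_
  -- With W moved to the left as its adjoint, both sides are matrix elements of E, and polarization
  -- makes each a combination of four positive measures.
  rw [← ContinuousLinearMap.adjoint_inner_left]
  set a := ContinuousLinearMap.adjoint W Φ with ha
  have h4 : (4 : ℂ) ≠ 0 := by norm_num
  refine mul_left_cancel₀ h4 ?_
  rw [inner_map_polarization_right, inner_map_polarization_right]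
  simp only [E.inner_proj_self _ hs, E.inner_proj_self _ (mΛ hs),
    ← E.measureReal_apply _ hs, ← E.measureReal_apply _ (mΛ hs)]
  have hm : ∀ Ψ, (E.measure Ψ).real (Λ ⁻¹' s) = ((E.measure Ψ).map Λ).real s := fun Ψ => by
    rw [map_measureReal_apply mΛ hs]
  simp only [hm]
  refine measureReal_combination_ext (fun t => ?_) s
  obtain ⟨x, hx⟩ := exists_bilin_eq_inner hη_symm hη t
  -- Invariance of η: pushing the measure forward by Λ amounts to replacing x by Λ⁻¹x.
  have hx' : ∀ p, η p (Λ.symm x) = inner ℝ (Λ p) t := fun p => by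
    rw [← hx, ← hΛ p, LinearEquiv.apply_symm_apply]
  simp only [hE.charFun_measure hx, hE.charFun_map_measure mΛ hx']
  have p1 := inner_map_polarization_right (trans U (Λ.symm x) : H →L[ℂ] H) a Ψ
  have p2 := inner_map_polarization_right (trans U x : H →L[ℂ] H) Φ (W Ψ)
  refine p1.symm.trans (Eq.trans ?_ p2)
  rw [ha, ContinuousLinearMap.adjoint_inner_left]
  simp only [ContinuousLinearEquiv.coe_coe]
  rw [hW, LinearEquiv.apply_symm_apply]

end Intertwine

end WarpedConvolution

namespace WarpedConvolution

open scoped ContDiff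
open MeasureTheory Filter Topology

/-! ### Comparison of |P|² with the Euclidean norm -/

section Weights

variable {d : ℕ}

theorem generatorSq_nonneg (η : LinearMap.BilinForm ℝ (Space d)) (p : Space d) :
    0 ≤ generatorSq η p :=
  Finset.sum_nonneg fun _ _ => sq_nonneg _

theorem sq_le_generatorSq (η : LinearMap.BilinForm ℝ (Space d)) (p : Space d) (j : Fin d) :
    (η p (EuclideanSpace.single j 1)) ^ 2 ≤ generatorSq η p :=
  Finset.single_le_sum (f := fun j => (η p (EuclideanSpace.single j 1)) ^ 2)
    (fun _ _ => sq_nonneg _) (Finset.mem_univ j)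

theorem continuous_bilin_left (η : LinearMap.BilinForm ℝ (Space d)) (x : Space d) :
    Continuous fun p => η p x :=
  LinearMap.continuous_of_finiteDimensional (η.flip x)

theorem continuous_generatorSq (η : LinearMap.BilinForm ℝ (Space d)) :
    Continuous (generatorSq η) :=
  continuous_finsetSum _ fun _ _ => (continuous_bilin_left η _).pow 2

/-- The components `η(p, e_j)`. -/
noncomputable def generatorMap (η : LinearMap.BilinForm ℝ (Space d)) : Space d →ₗ[ℝ] Space d :=
  (WithLp.linearEquiv 2 ℝ (Fin d → ℝ)).symm.toLinearMap ∘ₗ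
    LinearMap.pi fun j => η.flip (EuclideanSpace.single j 1)

theorem norm_generatorMap_sq (η : LinearMap.BilinForm ℝ (Space d)) (p : Space d) :
    ‖generatorMap η p‖ ^ 2 = generatorSq η p := by
  rw [EuclideanSpace.real_norm_sq_eq]
  rfl

theorem generatorMap_injective {η : LinearMap.BilinForm ℝ (Space d)} (hη : η.Nondegenerate) :
    Function.Injective (generatorMap η) := by
  rw [injective_iff_map_eq_zero]
  intro p hp
  refine hη.1 p fun x => ?_
  have h : ∀ j, η p (EuclideanSpace.single j 1) = 0 := fun j =>
    congrArg (fun v : Space d => v j) hp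
  have e : η p = 0 := (EuclideanSpace.basisFun (Fin d) ℝ).toBasis.ext fun j => by simpa using h j
  rw [e]; rfl

/-- Even for indefinite η, |p|² is the Euclidean square of the image of p under an injective linear
map, and such a map is bounded below in finite dimension. -/
theorem exists_one_add_norm_sq_le {η : LinearMap.BilinForm ℝ (Space d)} (hη : η.Nondegenerate) :
    ∃ C, ∀ p, 1 + ‖p‖ ^ 2 ≤ C * (1 + generatorSq η p) := by
  obtain ⟨K, -, hK⟩ := (generatorMap η).exists_antilipschitzWith
    (LinearMap.ker_eq_bot.2 (generatorMap_injective hη))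
  refine ⟨1 + (K : ℝ) ^ 2, fun p => ?_⟩
  have h : ‖p‖ ≤ K * ‖generatorMap η p‖ := by
    simpa using hK.le_mul_norm_sub p 0
  have h2 : ‖p‖ ^ 2 ≤ (K : ℝ) ^ 2 * generatorSq η p := by
    rw [← norm_generatorMap_sq, ← mul_pow]
    exact pow_le_pow_left₀ (norm_nonneg _) h 2
  nlinarith [generatorSq_nonneg η p, sq_nonneg (K : ℝ)]

theorem exists_one_add_generatorSq_le (η : LinearMap.BilinForm ℝ (Space d)) :
    ∃ C, ∀ p, 1 + generatorSq η p ≤ C * (1 + ‖p‖ ^ 2) := by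
  let A := (generatorMap η).toContinuousLinearMap
  refine ⟨1 + ‖A‖ ^ 2, fun p => ?_⟩
  have h2 : generatorSq η p ≤ ‖A‖ ^ 2 * ‖p‖ ^ 2 := by
    rw [← norm_generatorMap_sq, ← mul_pow]
    exact pow_le_pow_left₀ (norm_nonneg _) (A.le_opNorm p) 2
  nlinarith [sq_nonneg ‖A‖, sq_nonneg ‖p‖]

/-- The function `(1 + |p|²)⁻ⁿ`. -/
noncomputable def resolventFun (η : LinearMap.BilinForm ℝ (Space d)) (n : ℕ) (p : Space d) : ℂ :=
  ((((1 + generatorSq η p) ^ n)⁻¹ : ℝ) : ℂ)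

theorem measurable_resolventFun (η : LinearMap.BilinForm ℝ (Space d)) (n : ℕ) :
    Measurable (resolventFun η n) :=
  Complex.measurable_ofReal.comp
    (((continuous_generatorSq η).measurable.const_add 1).pow_const n).inv

theorem norm_resolventFun (η : LinearMap.BilinForm ℝ (Space d)) (n : ℕ) (p : Space d) :
    ‖resolventFun η n p‖ = ((1 + generatorSq η p) ^ n)⁻¹ := by
  have := generatorSq_nonneg η p
  rw [resolventFun, Complex.norm_real, Real.norm_of_nonneg (by positivity)]

theorem norm_resolventFun_le (η : LinearMap.BilinForm ℝ (Space d)) (n : ℕ) (p : Space d) :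
    ‖resolventFun η n p‖ ≤ 1 := by
  rw [norm_resolventFun]
  exact inv_le_one_of_one_le₀ (one_le_pow₀ (by linarith [generatorSq_nonneg η p]))

theorem resolventFun_add (η : LinearMap.BilinForm ℝ (Space d)) (m n : ℕ) (p : Space d) :
    resolventFun η (m + n) p = resolventFun η m p * resolventFun η n p := by
  rw [resolventFun, pow_add, mul_inv, Complex.ofReal_mul]
  rfl

end Weights

/-! ### Smooth vectors, bounded orbit maps and smooth families -/

section Translations

variable {H : Type*} [NormedAddCommGroup H] [InnerProductSpace ℂ H] {d : ℕ}

theorem trans_add (U : Multiplicative (Space d) →* (H ≃ₗᵢ[ℂ] H)) (x y : Space d) (Ψ : H) :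
    trans U (x + y) Ψ = trans U x (trans U y Ψ) := by
  simp only [trans, ofAdd_add, map_mul]
  rfl

theorem trans_zero (U : Multiplicative (Space d) →* (H ≃ₗᵢ[ℂ] H)) (Ψ : H) :
    trans U 0 Ψ = Ψ := by
  simp only [trans, ofAdd_zero, map_one]
  rfl

theorem trans_symm (U : Multiplicative (Space d) →* (H ≃ₗᵢ[ℂ] H)) (x : Space d) (Ψ : H) :
    (trans U x).symm Ψ = trans U (-x) Ψ := by
  rw [ContinuousLinearEquiv.symm_apply_eq, ← trans_add, add_neg_cancel, trans_zero]

theorem norm_trans (U : Multiplicative (Space d) →* (H ≃ₗᵢ[ℂ] H)) (x : Space d) (Ψ : H) :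
    ‖trans U x Ψ‖ = ‖Ψ‖ :=
  (U (Multiplicative.ofAdd x)).norm_map Ψ

theorem trans_mem_smoothVectors {U : Multiplicative (Space d) →* (H ≃ₗᵢ[ℂ] H)} {Ψ : H}
    (h : Ψ ∈ smoothVectors U) (x : Space d) : trans U x Ψ ∈ smoothVectors U := by
  change ContDiff ℝ ∞ fun y : Space d => trans U y (trans U x Ψ)
  simp_rw [← trans_add]
  exact ContDiff.comp (show ContDiff ℝ ∞ fun y : Space d => trans U y Ψ from h)
    (contDiff_id.add contDiff_const)

/-- Covariance writes f near x as a contraction composed with f near 0, so each derivative is at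
most as large as at the origin. -/
theorem derivsLE_of_covariant {V G : Type*} [NormedAddCommGroup V] [NormedSpace ℝ V]
    [NormedAddCommGroup G] [NormedSpace ℝ G] {f : V → G} (hf : ContDiff ℝ ∞ f)
    (h : ∀ x, ∃ L : G →L[ℝ] G, ‖L‖ ≤ 1 ∧ ∀ y, f (x + y) = L (f y)) :
    DerivsLE (fun _ => 1) f := by
  refine ⟨hf, fun n => ⟨‖iteratedFDeriv ℝ n f 0‖, fun x => ?_⟩⟩
  obtain ⟨L, hL, e⟩ := h x
  have h1 : iteratedFDeriv ℝ n f x = iteratedFDeriv ℝ n (fun y => f (x + y)) 0 := by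
    rw [iteratedFDeriv_comp_add_left, add_zero]
  rw [h1, show (fun y => f (x + y)) = L ∘ f from funext e, mul_one]
  refine (L.norm_iteratedFDeriv_comp_left hf.contDiffAt (mod_cast le_top)).trans ?_
  exact mul_le_of_le_one_left (norm_nonneg _) hL

/-- The orbit map of a smooth vector has bounded derivatives. -/
theorem derivsLE_trans {U : Multiplicative (Space d) →* (H ≃ₗᵢ[ℂ] H)} {Ψ : H}
    (h : Ψ ∈ smoothVectors U) : DerivsLE (fun _ => 1) fun x => trans U x Ψ := by
  refine derivsLE_of_covariant h fun x =>
    ⟨(trans U x : H →L[ℂ] H).restrictScalars ℝ, ?_, fun y => trans_add U x y Ψ⟩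
  refine ContinuousLinearMap.opNorm_le_bound _ zero_le_one fun Φ => ?_
  rw [one_mul]
  exact (norm_trans U x Φ).le

/-- The generator of `U` in direction `e`, on smooth vectors. -/
noncomputable def generator (U : Multiplicative (Space d) →* (H ≃ₗᵢ[ℂ] H)) (e : Space d) (Ψ : H) :
    H :=
  fderiv ℝ (fun y => trans U y Ψ) 0 e

theorem hasDerivAt_trans {U : Multiplicative (Space d) →* (H ≃ₗᵢ[ℂ] H)} {Ψ : H}
    (h : Ψ ∈ smoothVectors U) (e : Space d) :
    HasDerivAt (fun t : ℝ => trans U (t • e) Ψ) (generator U e Ψ) 0 := by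
  have h1 : HasFDerivAt (fun y => trans U y Ψ) (fderiv ℝ (fun y => trans U y Ψ) 0)
      ((0 : ℝ) • e) := by
    rw [zero_smul]
    exact ((show ContDiff ℝ ∞ fun y => trans U y Ψ from h).differentiable (by simp)).differentiableAt.hasFDerivAt
  have h2 : HasDerivAt (fun t : ℝ => t • e) ((1 : ℝ) • e) 0 := (hasDerivAt_id 0).smul_const e
  have h3 := h1.comp_hasDerivAt (0 : ℝ) h2
  rwa [one_smul] at h3

/-- `k` is a family of smooth vectors, with uniformly bounded derivatives. -/
def IsSmoothFamily (U : Multiplicative (Space d) →* (H ≃ₗᵢ[ℂ] H)) (k : Space d → H) : Prop :=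
  DerivsLE (fun _ => 1) fun z : Space d × Space d => trans U z.2 (k z.1)

theorem IsSmoothFamily.sub {U : Multiplicative (Space d) →* (H ≃ₗᵢ[ℂ] H)} {k k' : Space d → H}
    (h : IsSmoothFamily U k) (h' : IsSmoothFamily U k') :
    IsSmoothFamily U fun x => k x - k' x := by
  unfold IsSmoothFamily
  simp only [map_sub]
  exact DerivsLE.sub h h'

theorem IsSmoothFamily.sum {U : Multiplicative (Space d) →* (H ≃ₗᵢ[ℂ] H)} {ι : Type*}
    {k : ι → Space d → H} (s : Finset ι) (h : ∀ i ∈ s, IsSmoothFamily U (k i)) :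
    IsSmoothFamily U fun x => ∑ i ∈ s, k i x := by
  unfold IsSmoothFamily
  simp only [map_sum]
  exact DerivsLE.sum s h

theorem IsSmoothFamily.mem_smoothVectors {U : Multiplicative (Space d) →* (H ≃ₗᵢ[ℂ] H)}
    {k : Space d → H} (h : IsSmoothFamily U k) (x : Space d) : k x ∈ smoothVectors U :=
  ContDiff.comp (g := fun z : Space d × Space d => trans U z.2 (k z.1)) h.1
    (f := fun y => (x, y)) (contDiff_const.prodMk contDiff_id)

theorem IsSmoothFamily.derivsLE {U : Multiplicative (Space d) →* (H ≃ₗᵢ[ℂ] H)}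
    {k : Space d → H} (h : IsSmoothFamily U k) : DerivsLE (fun _ => 1) k := by
  have := DerivsLE.comp_clm h (ContinuousLinearMap.inl ℝ (Space d) (Space d))
  simpa [trans_zero] using this

/-- U(y) applied to the generator of k(x) is a partial derivative in y of the joint map (x, y) ↦
U(y)k(x). Joint smoothness is therefore preserved. -/
theorem IsSmoothFamily.generator {U : Multiplicative (Space d) →* (H ≃ₗᵢ[ℂ] H)}
    {k : Space d → H} (h : IsSmoothFamily U k) (e : Space d) :
    IsSmoothFamily U fun x => generator U e (k x) := by
  have h1 := DerivsLE.fderiv_apply h ((0, e) : Space d × Space d)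
  suffices key : (fun z : Space d × Space d =>
      trans U z.2 (WarpedConvolution.generator U e (k z.1))) =
      fun z => fderiv ℝ (fun z : Space d × Space d => trans U z.2 (k z.1)) z (0, e) by
    unfold IsSmoothFamily
    rw [key]
    exact h1
  refine funext fun z => ?_
  obtain ⟨x, y⟩ := z
  have h2 : HasDerivAt (fun t : ℝ => trans U (y + t • e) (k x))
      (fderiv ℝ (fun z : Space d × Space d => trans U z.2 (k z.1)) (x, y) (0, e)) 0 := by
    have a : HasFDerivAt (fun z : Space d × Space d => trans U z.2 (k z.1))
        (fderiv ℝ (fun z : Space d × Space d => trans U z.2 (k z.1)) (x, y))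
        (x, y + (0 : ℝ) • e) := by
      rw [zero_smul, add_zero]
      exact (ContDiff.differentiable h.1 (by simp)).differentiableAt.hasFDerivAt
    have b : HasDerivAt (fun t : ℝ => (x, y + t • e)) ((0 : Space d), (1 : ℝ) • e) 0 :=
      (hasDerivAt_const 0 x).prodMk (((hasDerivAt_id (0 : ℝ)).smul_const e).const_add y)
    have c := a.comp_hasDerivAt (0 : ℝ) b
    rwa [one_smul] at c
  have h3 : HasDerivAt (fun t : ℝ => trans U (y + t • e) (k x))
      (trans U y (WarpedConvolution.generator U e (k x))) 0 := by
    simp_rw [trans_add]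
    exact ((trans U y : H →L[ℂ] H).restrictScalars ℝ).hasFDerivAt.comp_hasDerivAt (0 : ℝ)
      (hasDerivAt_trans (h.mem_smoothVectors x) e)
  exact h3.unique h2

end Translations

/-! ### Powers of (1 + |P|²)⁻¹ and their inverses on smooth vectors -/

section Resolvent

variable {H : Type*} [NormedAddCommGroup H] [InnerProductSpace ℂ H] [CompleteSpace H] {d : ℕ}
  {η : LinearMap.BilinForm ℝ (Space d)} {U : Multiplicative (Space d) →* (H ≃ₗᵢ[ℂ] H)}
  {E : PVM (Space d) H}

/-- The operator `(1 + |P|²)⁻ⁿ`. -/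
noncomputable def resolvent (η : LinearMap.BilinForm ℝ (Space d)) (E : PVM (Space d) H) (n : ℕ) :
    H →L[ℂ] H :=
  E.op (resolventFun η n)

theorem isIntegral_resolvent (η : LinearMap.BilinForm ℝ (Space d)) (E : PVM (Space d) H) (n : ℕ) :
    E.IsIntegral (resolventFun η n) (resolvent η E n) :=
  E.isIntegral_op (measurable_resolventFun η n) (norm_resolventFun_le η n)

theorem resolvent_add (m n : ℕ) (Ψ : H) :
    resolvent η E (m + n) Ψ = resolvent η E m (resolvent η E n Ψ) := by
  rw [resolvent, show resolventFun η (m + n) = _ from funext (resolventFun_add η m n)]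
  exact PVM.op_mul_apply (measurable_resolventFun η m) (measurable_resolventFun η n)
    (norm_resolventFun_le η m) (norm_resolventFun_le η n) Ψ

theorem resolvent_zero (Ψ : H) : resolvent η E 0 Ψ = Ψ := by
  have h := (E.isIntegral_const 1).eq_op
  rw [resolvent, show resolventFun η 0 = fun _ => 1 by ext; simp [resolventFun], ← h]
  simp

/-- The squared norm of the image of Ψ is the integral of a strictly positive function against the
spectral measure of Ψ; if it vanishes, so does that measure, and its total mass is ‖Ψ‖². -/
theorem resolvent_injective (n : ℕ) : Function.Injective (resolvent η E n) := by
  rw [injective_iff_map_eq_zero]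
  intro Ψ h
  have h1 := (isIntegral_resolvent η E n).norm_sq (measurable_resolventFun η n)
    (norm_resolventFun_le η n) Ψ
  rw [h, norm_zero, zero_pow two_ne_zero] at h1
  have hint : Integrable (fun p => ‖resolventFun η n p‖ ^ 2) (E.measure Ψ) :=
    Integrable.of_bound ((measurable_resolventFun η n).norm.pow_const 2).aestronglyMeasurable 1
      (ae_of_all _ fun p => by
        rw [Real.norm_of_nonneg (by positivity)]
        exact pow_le_one₀ (norm_nonneg _) (norm_resolventFun_le η n p))
  have h2 := (integral_eq_zero_iff_of_nonneg (fun p => by positivity) hint).1 h1.symm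
  have h3 : ∀ᵐ p ∂(E.measure Ψ), False := by
    filter_upwards [h2] with p hp
    have hp' : ‖resolventFun η n p‖ = 0 := by simpa using hp
    have := generatorSq_nonneg η p
    rw [norm_resolventFun] at hp'
    have : 0 < ((1 + generatorSq η p) ^ n)⁻¹ := by positivity
    linarith
  have h4 : E.measure Ψ = 0 := by simpa using h3
  have h5 := E.measureReal_univ Ψ
  rw [h4] at h5
  simpa using h5.symm

theorem measurable_exp_bilin (η : LinearMap.BilinForm ℝ (Space d)) (x : Space d) :
    Measurable fun p => Complex.exp (Complex.I * (η p x : ℝ)) := by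
  have := continuous_bilin_left η x
  exact Continuous.measurable (by fun_prop)

theorem norm_exp_bilin (η : LinearMap.BilinForm ℝ (Space d)) (x p : Space d) :
    ‖Complex.exp (Complex.I * (η p x : ℝ))‖ ≤ 1 := by
  rw [mul_comm, Complex.norm_exp_ofReal_mul_I]

theorem IsSpectralResolution.trans_op_comm (hE : IsSpectralResolution η U E) {f : Space d → ℂ}
    (mf : Measurable f) {C : ℝ} (hf : ∀ p, ‖f p‖ ≤ C) (x : Space d) (Ψ : H) :
    trans U x (E.op f Ψ) = E.op f (trans U x Ψ) := by
  have h := PVM.op_comm_apply (E := E) mf (measurable_exp_bilin η x) hf (norm_exp_bilin η x) Ψ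
  rw [← (hE x).eq_op] at h
  exact h.symm

theorem IsSpectralResolution.trans_resolvent (hE : IsSpectralResolution η U E) (n : ℕ)
    (x : Space d) (Ψ : H) :
    trans U x (resolvent η E n Ψ) = resolvent η E n (trans U x Ψ) :=
  hE.trans_op_comm (measurable_resolventFun η n) (norm_resolventFun_le η n) x Ψ

theorem IsSpectralResolution.op_mem_smoothVectors (hE : IsSpectralResolution η U E)
    {f : Space d → ℂ} (mf : Measurable f) {C : ℝ} (hf : ∀ p, ‖f p‖ ≤ C) {Ψ : H}
    (h : Ψ ∈ smoothVectors U) : E.op f Ψ ∈ smoothVectors U := by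
  change ContDiff ℝ ∞ fun x => trans U x (E.op f Ψ)
  simp_rw [hE.trans_op_comm mf hf]
  exact ((E.op f).restrictScalars ℝ).contDiff.comp h

/-- Under f(P) the difference quotients of U become bounded functions of P, by |e^{is} - 1| ≤ |s|
and the bound on f·η(·, e). Bounded convergence identifies the limit. -/
theorem op_generator (hE : IsSpectralResolution η U E) {f : Space d → ℂ} (mf : Measurable f)
    {C : ℝ} (hf : ∀ p, ‖f p‖ ≤ C) {e : Space d} (hfe : ∀ p, ‖f p‖ * |η p e| ≤ C) {Ψ : H}
    (h : Ψ ∈ smoothVectors U) :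
    E.op f (generator U e Ψ) = E.op (fun p => f p * (Complex.I * (η p e : ℝ))) Ψ := by
  have h1 := (hasDerivAt_trans h e).tendsto_slope_zero
  simp only [zero_add, zero_smul, trans_zero] at h1
  have h2 := ((E.op f).continuous.tendsto _).comp h1
  let F : ℝ → Space d → ℂ := fun t p =>
    f p * ((t⁻¹ : ℝ) * (Complex.exp (Complex.I * (η p (t • e) : ℝ)) - 1))
  have mF : ∀ t, Measurable (F t) := fun t =>
    mf.mul (((measurable_exp_bilin η (t • e)).sub_const 1).const_mul _)
  have hFb : ∀ t p, ‖F t p‖ ≤ C := by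
    intro t p
    refine le_trans ?_ (hfe p)
    rw [norm_mul]
    refine mul_le_mul_of_nonneg_left ?_ (norm_nonneg _)
    rw [norm_mul, Complex.norm_real, norm_inv]
    -- At t = 0 the factor t⁻¹ is 0, so the bound is trivial there.
    rcases eq_or_ne t 0 with rfl | ht
    · simp
    · rw [inv_mul_le_iff₀ (norm_pos_iff.2 ht)]
      refine Real.norm_exp_I_mul_ofReal_sub_one_le.trans ?_
      rw [map_smul, smul_eq_mul, Real.norm_eq_abs, Real.norm_eq_abs, abs_mul]
  have hF : ∀ t, E.op f (t⁻¹ • (trans U (t • e) Ψ - Ψ)) = E.op (F t) Ψ := by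
    intro t
    have a := (((hE (t • e)).sub (E.isIntegral_const 1)).smul ((t⁻¹ : ℝ) : ℂ))
    have b := ((E.isIntegral_op mf hf).mul a mf hf).eq_op
    rw [← b]
    simp only [mul_apply_eq_comp, smul_apply, sub_apply, one_smul, map_smul,
      one_apply_eq_self, ContinuousLinearEquiv.coe_coe]
    rw [Complex.coe_smul]
    exact ((E.op f).restrictScalars ℝ).map_smul _ _
  have h3 := PVM.tendsto_op_apply (E := E) (l := 𝓝[≠] (0 : ℝ)) mF
    (f := fun p => f p * (Complex.I * (η p e : ℝ)))
    (mf.mul ((Complex.measurable_ofReal.comp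
      (continuous_bilin_left η e).measurable).const_mul _)) hFb
    (fun p => by simpa using hfe p) (fun p => by
      refine Tendsto.const_mul _ ?_
      have a : HasDerivAt (fun t : ℝ => Complex.exp (Complex.I * ((t * η p e : ℝ) : ℂ)))
          (Complex.I * (η p e : ℝ)) 0 := by
        have b : HasDerivAt (fun t : ℝ => ((t * η p e : ℝ) : ℂ)) ((1 * η p e : ℝ) : ℂ) 0 :=
          ((hasDerivAt_id (0 : ℝ)).mul_const (η p e)).ofReal_comp
        have c := (b.const_mul Complex.I).cexp
        simpa using c
      have b := a.tendsto_slope_zero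
      simpa using b) Ψ
  exact tendsto_nhds_unique h2 (h3.congr fun t => (hF t).symm)

theorem PVM.IsIntegral.sum {ι : Type*} {X : Type*} [MeasurableSpace X] {E : PVM X H}
    {f : ι → X → ℂ} {T : ι → H →L[ℂ] H} (s : Finset ι) (h : ∀ i ∈ s, E.IsIntegral (f i) (T i)) :
    E.IsIntegral (fun p => ∑ i ∈ s, f i p) (∑ i ∈ s, T i) := by
  classical
  induction s using Finset.induction_on with
  | empty => simpa using E.isIntegral_const 0
  | insert i s hi ih =>
    simp only [Finset.sum_insert hi]
    exact (h i (by simp)).add (ih fun j hj => h j (by simp [hj]))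

/-- `(1 + |P|²)⁻¹ (1 + |P|²) Ψ = Ψ` for smooth vectors `Ψ`. -/
theorem resolvent_one_laplacian (hE : IsSpectralResolution η U E) {k : Space d → H}
    (hk : IsSmoothFamily U k) (x : Space d) :
    resolvent η E 1 (k x - ∑ j, generator U (EuclideanSpace.single j 1)
      (generator U (EuclideanSpace.single j 1) (k x))) = k x := by
  let e : Fin d → Space d := fun j => EuclideanSpace.single j 1
  change resolvent η E 1 (k x - ∑ j, generator U (e j) (generator U (e j) (k x))) = k x
  have hpos := generatorSq_nonneg η
  -- The bounds `b1`, `b2`, `b3` allow `op_generator` to be used twice: 1+|p|² dominates both |η(p,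
  -- e_j)| and its square.
  have b1 : ∀ j p, ‖resolventFun η 1 p‖ * |η p (e j)| ≤ 1 := fun j p => by
    rw [norm_resolventFun, pow_one, inv_mul_le_iff₀ (by linarith [hpos p])]
    have := sq_le_generatorSq η p j
    rw [← sq_abs] at this
    nlinarith [sq_nonneg (|η p (e j)| - 1), abs_nonneg (η p (e j))]
  have b2 : ∀ j p, ‖resolventFun η 1 p * (Complex.I * (η p (e j) : ℝ))‖ ≤ 1 := fun j p => by
    simpa using b1 j p
  have b3 : ∀ j p, ‖resolventFun η 1 p * (Complex.I * (η p (e j) : ℝ))‖ * |η p (e j)| ≤ 1 :=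
    fun j p => by
      have := sq_le_generatorSq η p j
      rw [← sq_abs] at this
      rw [norm_mul, norm_resolventFun, norm_mul, Complex.norm_I, Complex.norm_real, one_mul,
        Real.norm_eq_abs, pow_one, mul_assoc, inv_mul_le_iff₀ (by linarith [hpos p])]
      nlinarith
  have m1 := measurable_resolventFun η 1
  have m2 : ∀ j, Measurable fun p => resolventFun η 1 p * (Complex.I * (η p (e j) : ℝ)) :=
    fun j => m1.mul ((Complex.measurable_ofReal.comp
      (continuous_bilin_left η (e j)).measurable).const_mul _)
  have m3 : ∀ j, Measurable fun p => resolventFun η 1 p * (Complex.I * (η p (e j) : ℝ)) *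
      (Complex.I * (η p (e j) : ℝ)) :=
    fun j => (m2 j).mul ((Complex.measurable_ofReal.comp
      (continuous_bilin_left η (e j)).measurable).const_mul _)
  have h1 : ∀ j, resolvent η E 1 (generator U (e j) (generator U (e j) (k x))) =
      E.op (fun p => resolventFun η 1 p * (Complex.I * (η p (e j) : ℝ)) *
        (Complex.I * (η p (e j) : ℝ))) (k x) := by
    intro j
    rw [resolvent, op_generator hE m1 (norm_resolventFun_le η 1) (b1 j)
      ((hk.generator (e j)).mem_smoothVectors x),
      op_generator hE (m2 j) (b2 j) (b3 j) (hk.mem_smoothVectors x)]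
  have hi := (isIntegral_resolvent η E 1).sub (PVM.IsIntegral.sum Finset.univ fun j _ =>
    E.isIntegral_op (m3 j) (C := 1) (fun p => by
      have := b3 j p
      rw [norm_mul _ (Complex.I * _), norm_mul Complex.I, Complex.norm_I, one_mul,
        Complex.norm_real]
      exact this))
  -- The derivatives of U carry a factor i, so their squares contribute -η(p, e_j)²; this explains
  -- the minus sign.
  have e1 : (fun p => resolventFun η 1 p - ∑ j, resolventFun η 1 p *
      (Complex.I * (η p (e j) : ℝ)) * (Complex.I * (η p (e j) : ℝ))) = fun _ => 1 := by
    ext p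
    have hne : (1 + generatorSq η p : ℝ) ≠ 0 := by linarith [hpos p]
    have : ∀ j, resolventFun η 1 p * (Complex.I * (η p (e j) : ℝ)) * (Complex.I * (η p (e j) : ℝ))
        = -(resolventFun η 1 p * (((η p (e j)) ^ 2 : ℝ) : ℂ)) := fun j => by
      push_cast
      linear_combination (resolventFun η 1 p * ((η p (e j) : ℝ) : ℂ) ^ 2) * Complex.I_sq
    simp only [this]
    rw [Finset.sum_neg_distrib, ← Finset.mul_sum, sub_neg_eq_add, ← Complex.ofReal_sum,
      show ∑ j, (η p (e j)) ^ 2 = generatorSq η p from rfl, resolventFun, pow_one]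
    rw [← Complex.ofReal_mul, ← Complex.ofReal_add, ← Complex.ofReal_one]
    congr 1
    field_simp
  rw [e1] at hi
  have h2 := hi.unique (E.isIntegral_const 1)
  have h3 := congrArg (fun T : H →L[ℂ] H => T (k x)) h2
  simp only [one_smul, one_apply_eq_self, sub_apply] at h3
  rw [map_sub, map_sum]
  simp only [h1]
  refine Eq.trans ?_ h3
  congr 1
  rw [sum_apply]

/-- Smooth families are stable under 1+|P|², a differential operator in the group variable, and the
resolvent undoes it. Iterating n times gives k'. -/
theorem IsSmoothFamily.exists_resolvent_eq (hE : IsSpectralResolution η U E) {k : Space d → H}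
    (hk : IsSmoothFamily U k) (n : ℕ) :
    ∃ k', IsSmoothFamily U k' ∧ ∀ x, resolvent η E n (k' x) = k x := by
  induction n generalizing k with
  | zero => exact ⟨k, hk, fun x => resolvent_zero _⟩
  | succ n ih =>
    obtain ⟨k', hk', e⟩ := ih (hk.sub (IsSmoothFamily.sum Finset.univ fun j _ =>
      (hk.generator (EuclideanSpace.single j 1)).generator (EuclideanSpace.single j 1)))
    refine ⟨k', hk', fun x => ?_⟩
    rw [add_comm, resolvent_add, e]
    exact resolvent_one_laplacian hE hk x

theorem isSmoothFamily_const {H : Type*} [NormedAddCommGroup H] [InnerProductSpace ℂ H]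
    {U : Multiplicative (Space d) →* (H ≃ₗᵢ[ℂ] H)} {Ψ : H} (h : Ψ ∈ smoothVectors U) : IsSmoothFamily U fun _ => Ψ :=
  (derivsLE_trans h).comp_clm (ContinuousLinearMap.snd ℝ (Space d) (Space d))

theorem exists_resolvent_eq (hE : IsSpectralResolution η U E) {Ψ : H} (h : Ψ ∈ smoothVectors U)
    (n : ℕ) : ∃ Φ ∈ smoothVectors U, resolvent η E n Φ = Ψ := by
  obtain ⟨k, hk, e⟩ := (isSmoothFamily_const h).exists_resolvent_eq hE n
  exact ⟨k 0, hk.mem_smoothVectors 0, e 0⟩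

end Resolvent

end WarpedConvolution

namespace WarpedConvolution

open scoped ContDiff Convolution
open MeasureTheory Filter Topology

/-! ### Density of the smooth vectors -/

section Density

variable {H : Type*} [NormedAddCommGroup H] [InnerProductSpace ℂ H] {d : ℕ}

/-- Gårding's argument: translating the averaged vector by U(x) evaluates the convolution of φ with
the orbit at x, and this is smooth in x because φ is. -/
theorem convolution_trans_mem_smoothVectors {U : Multiplicative (Space d) →* (H ≃ₗᵢ[ℂ] H)}
    (hU : ∀ Ψ : H, Continuous fun x : Space d => U (Multiplicative.ofAdd x) Ψ)
    {φ : Space d → ℝ} (hφ : ContDiff ℝ ∞ φ) (hc : HasCompactSupport φ) (Ψ : H) :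
    (φ ⋆[ContinuousLinearMap.lsmul ℝ ℝ, volume] fun x => trans U x Ψ) 0 ∈ smoothVectors U := by
  have hcont : Continuous fun x => trans U x Ψ := hU Ψ
  have h := hc.contDiff_convolution_left (ContinuousLinearMap.lsmul ℝ ℝ) (n := ⊤) hφ
    (hcont.locallyIntegrable (μ := volume))
  refine (show ContDiff ℝ ∞ fun x => trans U x _ from ?_)
  refine (congrArg (ContDiff ℝ ∞) (funext fun x => ?_)).mpr h
  simp only [convolution_def, ContinuousLinearMap.lsmul_apply]
  refine (((trans U x).restrictScalars ℝ).integral_comp_comm _).symm.trans ?_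
  refine integral_congr_ae (ae_of_all _ fun t => ?_)
  change trans U x (φ t • trans U (0 - t) Ψ) = φ t • trans U (x - t) Ψ
  rw [zero_sub, sub_eq_add_neg, trans_add]
  exact ((trans U x : H →L[ℂ] H).restrictScalars ℝ).map_smul (φ t) _

/-- The smooth vectors are dense. -/
theorem dense_smoothVectors [CompleteSpace H] {U : Multiplicative (Space d) →* (H ≃ₗᵢ[ℂ] H)}
    (hU : ∀ Ψ : H, Continuous fun x : Space d => U (Multiplicative.ofAdd x) Ψ) :
    Dense (smoothVectors U : Set H) := by
  intro Ψ
  let φ : ℕ → ContDiffBump (0 : Space d) := fun n =>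
    ⟨1 / ((n : ℝ) + 1) / 2, 1 / ((n : ℝ) + 1), by positivity, half_lt_self (by positivity)⟩
  have h := ContDiffBump.convolution_tendsto_right_of_continuous (μ := (volume : Measure (Space d)))
    (φ := φ) (l := atTop) tendsto_one_div_add_atTop_nhds_zero_nat
    (show Continuous fun x => trans U x Ψ from hU Ψ) 0
  rw [trans_zero] at h
  exact mem_closure_of_tendsto h (Eventually.of_forall fun n =>
    convolution_trans_mem_smoothVectors hU (φ n).contDiff_normed (φ n).hasCompactSupport_normed Ψ)

end Density

/-! ### Smooth operators and existence of warped convolutions -/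

section Operators

variable {H : Type*} [NormedAddCommGroup H] [InnerProductSpace ℂ H]

theorem mem_domain_conj {W : H ≃L[ℂ] H} {F : H →ₗ.[ℂ] H} {Ψ : H} :
    Ψ ∈ (conj W F).domain ↔ W.symm Ψ ∈ F.domain :=
  Iff.rfl

theorem value_conj (W : H ≃L[ℂ] H) (F : H →ₗ.[ℂ] H) (Ψ : H) :
    value (conj W F) Ψ = W (value F (W.symm Ψ)) := by
  by_cases h : W.symm Ψ ∈ F.domain
  · rw [value_of_mem F h, value_of_mem (conj W F) (mem_domain_conj.2 h)]
    rfl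
  · rw [value, value, dif_neg h, dif_neg (fun h' => h (mem_domain_conj.1 h')), map_zero]

variable {d : ℕ} {U : Multiplicative (Space d) →* (H ≃ₗᵢ[ℂ] H)}

theorem mem_domain_conj_trans {F : H →ₗ.[ℂ] H} (h : smoothVectors U ≤ F.domain) {Ψ : H}
    (hΨ : Ψ ∈ smoothVectors U) (x : Space d) : Ψ ∈ (conj (trans U x) F).domain := by
  rw [mem_domain_conj, trans_symm]
  exact h (trans_mem_smoothVectors hΨ _)

theorem value_conj_trans (F : H →ₗ.[ℂ] H) (x y : Space d) (Ψ : H) :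
    value (conj (trans U (x + y)) F) (trans U y Ψ) = trans U y (value (conj (trans U x) F) Ψ) := by
  have h : (trans U (x + y)).symm (trans U y Ψ) = (trans U x).symm Ψ := by
    rw [trans_symm, trans_symm, ← trans_add, neg_add, add_assoc, neg_add_cancel, add_zero]
  rw [value_conj, value_conj, h, add_comm x y, trans_add]

variable [CompleteSpace H] {η : LinearMap.BilinForm ℝ (Space d)} {E : PVM (Space d) H}

theorem IsSpectralResolution.resolvent_mem_smoothVectors (hE : IsSpectralResolution η U E) (n : ℕ) {Ψ : H}
    (h : Ψ ∈ smoothVectors U) : resolvent η E n Ψ ∈ smoothVectors U :=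
  hE.op_mem_smoothVectors (measurable_resolventFun η n) (norm_resolventFun_le η n) h

/-- A reformulation of membership in the class of smooth operators. -/
theorem isSmoothOperator_iff (hE : IsSpectralResolution η U E) {F : H →ₗ.[ℂ] H} :
    IsSmoothOperator η U E F ↔ smoothVectors U ≤ F.domain ∧
      ∃ (n : ℕ) (T : Space d → H →L[ℂ] H), ContDiff ℝ ∞ T ∧ ∀ x, ∀ Ψ ∈ smoothVectors U,
        T x Ψ = resolvent η E n (value (conj (trans U x) F) (resolvent η E n Ψ)) := by
  constructor
  · rintro ⟨h, n, R, T, hR, hT, e⟩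
    obtain rfl : R = resolvent η E n := hR.eq_op
    refine ⟨h, n, T, hT, fun x Ψ hΨ => ?_⟩
    obtain ⟨h1, h2⟩ := e x Ψ hΨ
    rw [h2, value_of_mem _ h1]
  · rintro ⟨h, n, T, hT, e⟩
    refine ⟨h, n, resolvent η E n, T, isIntegral_resolvent η E n, hT, fun x Ψ hΨ => ?_⟩
    have h1 := mem_domain_conj_trans h (hE.resolvent_mem_smoothVectors n hΨ) x
    exact ⟨h1, by rw [e x Ψ hΨ, value_of_mem _ h1]⟩

/-- The real linear map `S ↦ A S C` on bounded operators. -/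
noncomputable def sandwich {H : Type*} [NormedAddCommGroup H] [InnerProductSpace ℂ H]
    (A C : H →L[ℂ] H) : (H →L[ℂ] H) →L[ℝ] (H →L[ℂ] H) :=
  LinearMap.mkContinuous
    { toFun := fun S => A ∘L S ∘L C
      map_add' := fun S S' => by ext; simp
      map_smul' := fun c S => by
        ext Ψ
        exact (A.restrictScalars ℝ).map_smul c _ } (‖A‖ * ‖C‖) (fun S => by
    refine (A.opNorm_comp_le _).trans ?_
    rw [mul_assoc, mul_comm ‖C‖]
    exact mul_le_mul_of_nonneg_left (S.opNorm_comp_le C) (norm_nonneg _))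

theorem norm_sandwich_trans_le {H : Type*} [NormedAddCommGroup H] [InnerProductSpace ℂ H] {d : ℕ}
    (U : Multiplicative (Space d) →* (H ≃ₗᵢ[ℂ] H)) (x y : Space d) :
    ‖sandwich (trans U x : H →L[ℂ] H) (trans U y)‖ ≤ 1 := by
  have h : ∀ x, ‖(trans U x : H →L[ℂ] H)‖ ≤ 1 := fun x =>
    ContinuousLinearMap.opNorm_le_bound _ zero_le_one fun Ψ => by
      rw [one_mul]; exact (norm_trans U x Ψ).le
  exact (LinearMap.mkContinuous_norm_le _ (by positivity) _).trans
    (mul_le_one₀ (h x) (norm_nonneg _) (h y))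

/-- Extra decay in P is gained at no cost in x: smoothness of x ↦ T(x) is, by covariance, also
smoothness of T(x)Φ under translations, so further resolvents can be split off. -/
theorem IsSmoothOperator.exists_smoothFamily (hE : IsSpectralResolution η U E)
    (hU : ∀ Ψ : H, Continuous fun x : Space d => U (Multiplicative.ofAdd x) Ψ)
    {F : H →ₗ.[ℂ] H} (hF : IsSmoothOperator η U E F) {Ψ : H} (hΨ : Ψ ∈ smoothVectors U) (N : ℕ) :
    ∃ k, IsSmoothFamily U k ∧ ∀ x, value (conj (trans U x) F) Ψ = resolvent η E N (k x) := by
  obtain ⟨-, n, T, hT, e⟩ := (isSmoothOperator_iff hE).1 hF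
  have cov : ∀ x y, ∀ Φ ∈ smoothVectors U, T (x + y) (trans U y Φ) = trans U y (T x Φ) := by
    intro x y Φ hΦ
    rw [e _ _ (trans_mem_smoothVectors hΦ y), e _ _ hΦ, ← hE.trans_resolvent, value_conj_trans,
      ← hE.trans_resolvent]
  have hTb : DerivsLE (fun _ => 1) T := by
    refine derivsLE_of_covariant hT fun x =>
      ⟨sandwich (trans U x) (trans U (-x)), norm_sandwich_trans_le U _ _, fun y => ?_⟩
    -- T is prescribed only on smooth vectors; density extends the covariance to all vectors.
    refine ContinuousLinearMap.ext_on (s := (smoothVectors U : Set H)) ?_ fun Φ hΦ => ?_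
    · rw [Submodule.span_eq]
      exact dense_smoothVectors hU
    · have h1 := cov y x (trans U (-x) Φ) (trans_mem_smoothVectors hΦ _)
      rw [← trans_add, add_neg_cancel, trans_zero, add_comm] at h1
      exact h1
  obtain ⟨Φ, hΦ, rfl⟩ := exists_resolvent_eq hE hΨ n
  have hk : IsSmoothFamily U fun x => T x Φ := by
    have h1 := DerivsLE.bilin (hTb.comp_clm (ContinuousLinearMap.fst ℝ (Space d) (Space d) +
      ContinuousLinearMap.snd ℝ (Space d) (Space d)))
      ((derivsLE_trans hΦ).comp_clm (ContinuousLinearMap.snd ℝ (Space d) (Space d)))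
      (ContinuousLinearMap.restrictScalarsL ℂ H H ℝ ℝ)
    simp only [mul_one] at h1
    unfold IsSmoothFamily
    convert h1 using 2 with z
    exact (cov z.1 z.2 Φ hΦ).symm
  -- Of the n + N resolvents, n cancel the left factor in T by injectivity and N remain.
  obtain ⟨k, hk', e'⟩ := hk.exists_resolvent_eq hE (n + N)
  refine ⟨k, hk', fun x => resolvent_injective (η := η) (E := E) n ?_⟩
  rw [← resolvent_add, e', e x Φ hΦ]

theorem exists_norm_resolventFun_mul_le (hη : η.Nondegenerate) (N : ℕ) :
    ∃ C, ∀ p, ‖resolventFun η N p‖ * (1 + ‖p‖ ^ 2) ^ N ≤ C := by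
  obtain ⟨C, hC⟩ := exists_one_add_norm_sq_le hη
  refine ⟨C ^ N, fun p => ?_⟩
  have h := generatorSq_nonneg η p
  rw [norm_resolventFun, inv_mul_le_iff₀ (by positivity), ← mul_pow]
  refine pow_le_pow_left₀ (by positivity) ?_ N
  rw [mul_comm]
  exact hC p

theorem IsSmoothOperator.exists_hasIntegral (hη : η.Nondegenerate)
    (hE : IsSpectralResolution η U E)
    (hU : ∀ Ψ : H, Continuous fun x : Space d => U (Multiplicative.ofAdd x) Ψ)
    {F : H →ₗ.[ℂ] H} (hF : IsSmoothOperator η U E F) (Q : Space d →ₗ[ℝ] Space d) {Ψ : H}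
    (hΨ : Ψ ∈ smoothVectors U) : ∃ Φ, HasIntegral E (integrand U Q F Ψ) Φ := by
  -- The weight of exponent d + 1 is integrable because d < 2(d + 1).
  obtain ⟨k, hk, e⟩ := hF.exists_smoothFamily hE hU hΨ (d + 1)
  obtain ⟨C, hC⟩ := exists_norm_resolventFun_mul_le hη (d + 1)
  obtain ⟨Φ, h⟩ := exists_hasIntegral_of_derivsLE E (measurable_resolventFun η (d + 1)) (M := d + 1)
    (by rw [finrank_euclideanSpace, Fintype.card_fin]; omega) hC
    (hk.derivsLE.comp_clm Q.toContinuousLinearMap)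
  have e' : integrand U Q F Ψ = _ := funext fun p => e (Q p)
  exact ⟨Φ, e' ▸ h⟩

theorem IsSmoothOperator.warp_domain (hη : η.Nondegenerate)
    (hE : IsSpectralResolution η U E)
    (hU : ∀ Ψ : H, Continuous fun x : Space d => U (Multiplicative.ofAdd x) Ψ)
    {F : H →ₗ.[ℂ] H} (hF : IsSmoothOperator η U E F) (Q : Space d →ₗ[ℝ] Space d) :
    (warp U E Q F).domain = smoothVectors U := by
  ext Ψ
  exact ⟨fun h => h.1, fun h => ⟨h, fun p => mem_domain_conj_trans hF.1 h _,
    hF.exists_hasIntegral hη hE hU Q h⟩⟩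

theorem hasIntegral_warp (Q : Space d →ₗ[ℝ] Space d) (F : H →ₗ.[ℂ] H)
    (Ψ : (warp U E Q F).domain) : HasIntegral E (integrand U Q F Ψ) (warp U E Q F Ψ) :=
  Ψ.2.2.2.choose_spec

end Operators

/-! ### Transformation under intertwining operators -/

section Covariance

variable {H : Type*} [NormedAddCommGroup H] [InnerProductSpace ℂ H] {d : ℕ}
  {η : LinearMap.BilinForm ℝ (Space d)} {U : Multiplicative (Space d) →* (H ≃ₗᵢ[ℂ] H)}
  {Λ : Space d ≃ₗ[ℝ] Space d} {W : H ≃L[ℂ] H}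

theorem symm_trans_of_intertwine (hW : ∀ x Ψ, W (trans U x Ψ) = trans U (Λ x) (W Ψ))
    (x : Space d) (Ψ : H) : W.symm (trans U (Λ x) Ψ) = trans U x (W.symm Ψ) := by
  rw [ContinuousLinearEquiv.symm_apply_eq, hW, ContinuousLinearEquiv.apply_symm_apply]

theorem apply_mem_smoothVectors (hW : ∀ x Ψ, W (trans U x Ψ) = trans U (Λ x) (W Ψ)) {Ψ : H}
    (h : Ψ ∈ smoothVectors U) : W Ψ ∈ smoothVectors U := by
  change ContDiff ℝ ∞ fun x => trans U x (W Ψ)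
  have e : (fun x => trans U x (W Ψ)) = fun x => W (trans U (Λ.symm x) Ψ) := by
    ext x
    rw [hW, LinearEquiv.apply_symm_apply]
  rw [e]
  exact ((W : H →L[ℂ] H).restrictScalars ℝ).contDiff.comp
    (ContDiff.comp (show ContDiff ℝ ∞ fun x => trans U x Ψ from h)
      (Λ.symm.toContinuousLinearEquiv : Space d →L[ℝ] Space d).contDiff)

theorem symm_intertwine (hW : ∀ x Ψ, W (trans U x Ψ) = trans U (Λ x) (W Ψ)) (x : Space d)
    (Ψ : H) : W.symm (trans U x Ψ) = trans U (Λ.symm x) (W.symm Ψ) := by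
  rw [← symm_trans_of_intertwine hW, LinearEquiv.apply_symm_apply]

theorem value_conj_conj (hW : ∀ x Ψ, W (trans U x Ψ) = trans U (Λ x) (W Ψ)) (F : H →ₗ.[ℂ] H)
    (x : Space d) (Ψ : H) : value (conj (trans U x) (conj W F)) Ψ =
      W (value (conj (trans U (Λ.symm x)) F) (W.symm Ψ)) := by
  rw [value_conj, value_conj, value_conj, hW, LinearEquiv.apply_symm_apply, trans_symm,
    symm_intertwine hW, trans_symm, map_neg]

theorem integrand_conj (hW : ∀ x Ψ, W (trans U x Ψ) = trans U (Λ x) (W Ψ))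
    (Q : Space d →ₗ[ℝ] Space d) (F : H →ₗ.[ℂ] H) (Ψ : H) (p : Space d) :
    integrand U (Λ.toLinearMap ∘ₗ Q ∘ₗ Λ.symm.toLinearMap) (conj W F) Ψ (Λ p) =
      W (integrand U Q F (W.symm Ψ) p) := by
  rw [integrand, integrand, value_conj_conj hW]
  simp

/-- The comparison goes through the Euclidean norm, for which Λ is bounded. -/
theorem exists_generatorSq_comp_le (hη : η.Nondegenerate) (Λ : Space d →ₗ[ℝ] Space d) :
    ∃ C, ∀ p, 1 + generatorSq η (Λ p) ≤ C * (1 + generatorSq η p) := by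
  obtain ⟨A, hA⟩ := exists_one_add_norm_sq_le hη
  obtain ⟨B, hB⟩ := exists_one_add_generatorSq_le η
  let L := Λ.toContinuousLinearMap
  have hB0 : 0 ≤ B := by
    have := hB 0
    have := generatorSq_nonneg η 0
    simp at *
    linarith
  refine ⟨B * ((1 + ‖L‖ ^ 2) * A), fun p => (hB _).trans ?_⟩
  rw [mul_assoc, mul_assoc]
  have h1 : ‖Λ p‖ ^ 2 ≤ ‖L‖ ^ 2 * ‖p‖ ^ 2 := by
    rw [← mul_pow]
    exact pow_le_pow_left₀ (norm_nonneg _) (L.le_opNorm p) 2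
  gcongr
  calc 1 + ‖Λ p‖ ^ 2 ≤ (1 + ‖L‖ ^ 2) * (1 + ‖p‖ ^ 2) := by
        nlinarith [sq_nonneg ‖L‖, sq_nonneg ‖p‖]
    _ ≤ _ := by gcongr; exact hA p

variable [CompleteSpace H] {E : PVM (Space d) H}

/-- `W⁻¹ (1 + |P|²)⁻ⁿ W` differs from `(1 + |P|²)⁻ⁿ` by a bounded function of `P`. -/
theorem exists_symm_resolvent (hη_symm : η.IsSymm) (hη : η.Nondegenerate)
    (hE : IsSpectralResolution η U E) (hΛ : ∀ x y, η (Λ x) (Λ y) = η x y)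
    (hW : ∀ x Ψ, W (trans U x Ψ) = trans U (Λ x) (W Ψ)) (n : ℕ) :
    ∃ B : H →L[ℂ] H, (∀ Ψ ∈ smoothVectors U, B Ψ ∈ smoothVectors U) ∧
      (∀ Ψ, resolvent η E n (W Ψ) = W (B (resolvent η E n Ψ))) ∧
      ∀ Ψ, resolvent η E n (W Ψ) = W (resolvent η E n (B Ψ)) := by
  obtain ⟨C, hC⟩ := exists_generatorSq_comp_le hη (Λ.symm : Space d →ₗ[ℝ] Space d)
  have hpos := generatorSq_nonneg η
  have mΛ : Measurable Λ := Λ.toContinuousLinearEquiv.continuous.measurable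
  -- This is the quotient of the weights at Λp and at p, bounded by the comparison for Λ⁻¹ at the
  -- point Λp.
  let b : Space d → ℂ := fun p => (((1 + generatorSq η p) ^ n *
    ((1 + generatorSq η (Λ p)) ^ n)⁻¹ : ℝ) : ℂ)
  have mb : Measurable b := Complex.measurable_ofReal.comp
    ((((continuous_generatorSq η).measurable.const_add 1).pow_const n).mul
      ((((continuous_generatorSq η).measurable.comp mΛ).const_add 1).pow_const n).inv)
  have hb : ∀ p, ‖b p‖ ≤ C ^ n := fun p => by
    have h1 := hpos p
    have h2 := hpos (Λ p)
    have h3 := hC (Λ p)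
    simp only [LinearEquiv.coe_coe, LinearEquiv.symm_apply_apply] at h3
    simp only [b]
    rw [Complex.norm_real, Real.norm_of_nonneg (by positivity), ← div_eq_mul_inv,
      div_le_iff₀ (by positivity), ← mul_pow]
    exact pow_le_pow_left₀ (by positivity) h3 n
  have e : (fun p => resolventFun η n (Λ p)) = fun p => b p * resolventFun η n p := by
    ext p
    have h1 : (1 + generatorSq η p) ^ n ≠ 0 := by have := hpos p; positivity
    simp only [b, resolventFun]
    rw [← Complex.ofReal_mul]
    congr 1
    field_simp
  have key : ∀ Ψ, resolvent η E n (W Ψ) = W (E.op (fun p => resolventFun η n (Λ p)) Ψ) := fun Ψ =>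
    (PVM.op_comp_intertwine (E := E) (E' := E) mΛ (W : H →L[ℂ] H)
      (fun s hs Ψ => hE.intertwine hη_symm hη hΛ hW hs Ψ) (measurable_resolventFun η n)
      (norm_resolventFun_le η n) Ψ).symm
  have k1 : ∀ Ψ, resolvent η E n (W Ψ) = W (E.op b (resolvent η E n Ψ)) := fun Ψ => by
    rw [key, e, PVM.op_mul_apply mb (measurable_resolventFun η n) hb (norm_resolventFun_le η n)]
    rfl
  refine ⟨E.op b, fun Ψ h => hE.op_mem_smoothVectors mb hb h, k1, fun Ψ => ?_⟩
  rw [k1, resolvent, PVM.op_comm_apply mb (measurable_resolventFun η n) hb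
    (norm_resolventFun_le η n)]

/-- Moving W through the resolvents produces a factor B on each side, so the function for W F W⁻¹ is
W B T(Λ⁻¹x) B W⁻¹, smooth in norm with T. Both forms of `exists_symm_resolvent` enter, one on either
side of F. -/
theorem IsSmoothOperator.conj_of_intertwine (hη_symm : η.IsSymm) (hη : η.Nondegenerate)
    (hE : IsSpectralResolution η U E) (hΛ : ∀ x y, η (Λ x) (Λ y) = η x y)
    (hW : ∀ x Ψ, W (trans U x Ψ) = trans U (Λ x) (W Ψ)) {F : H →ₗ.[ℂ] H}
    (hF : IsSmoothOperator η U E F) : IsSmoothOperator η U E (conj W F) := by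
  obtain ⟨hD, n, T, hT, e⟩ := (isSmoothOperator_iff hE).1 hF
  obtain ⟨B, hB, k1, k2⟩ := exists_symm_resolvent hη_symm hη hE hΛ hW n
  have hWs : ∀ Ψ ∈ smoothVectors U, W.symm Ψ ∈ smoothVectors U := fun Ψ h =>
    apply_mem_smoothVectors (W := W.symm) (Λ := Λ.symm) (symm_intertwine hW) h
  refine (isSmoothOperator_iff hE).2 ⟨fun Ψ h => mem_domain_conj.2 (hD (hWs Ψ h)), n,
    fun x => sandwich ((W : H →L[ℂ] H) ∘L B) (B ∘L (W.symm : H →L[ℂ] H)) (T (Λ.symm x)), ?_, ?_⟩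
  · exact (sandwich _ _).contDiff.comp (hT.comp
      (Λ.symm.toContinuousLinearEquiv : Space d →L[ℝ] Space d).contDiff)
  · intro x Ψ hΨ
    change W (B (T (Λ.symm x) (B (W.symm Ψ)))) = _
    have h := k2 (W.symm Ψ)
    rw [ContinuousLinearEquiv.apply_symm_apply] at h
    rw [e _ _ (hB _ (hWs Ψ hΨ)), value_conj_conj hW, k1, h,
      ContinuousLinearEquiv.symm_apply_apply]

theorem IsTaggedPartition.preimage {δ δ' : ℝ} {Δ : ℕ → Set (Space d)} {t : ℕ → Space d}
    (hp : IsTaggedPartition δ Δ t) (Λ : Space d ≃ₗ[ℝ] Space d)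
    (hδ : ∀ x, ‖x‖ < δ → ‖Λ.symm x‖ < δ') :
    IsTaggedPartition δ' (fun i => Λ ⁻¹' Δ i) (fun i => Λ.symm (t i)) where
  measurableSet i := Λ.toContinuousLinearEquiv.continuous.measurable (hp.measurableSet i)
  disjoint i j hij := (hp.disjoint hij).preimage Λ
  iUnion_eq := by rw [← Set.preimage_iUnion, hp.iUnion_eq, Set.preimage_univ]
  dist_lt i p hpi := by
    have h := hδ (Λ p - t i) (by rw [← dist_eq_norm]; exact hp.dist_lt i _ hpi)
    rw [map_sub, LinearEquiv.symm_apply_apply] at h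
    rwa [dist_eq_norm]

/-- Pulling a partition for g' back by Λ gives one for g whose mesh grows by at most ‖Λ⁻¹‖, and W
maps the sum of the latter term by term to the sum of the former. -/
theorem HasIntegral.intertwine (hη_symm : η.IsSymm) (hη : η.Nondegenerate)
    (hE : IsSpectralResolution η U E) (hΛ : ∀ x y, η (Λ x) (Λ y) = η x y)
    (hW : ∀ x Ψ, W (trans U x Ψ) = trans U (Λ x) (W Ψ)) {g g' : Space d → H}
    (hg : ∀ p, g' (Λ p) = W (g p)) {Φ : H} (h : HasIntegral E g Φ) :
    HasIntegral E g' (W Φ) := by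
  intro ε hε
  obtain ⟨δ, hδ, hS⟩ := h (ε / (‖(W : H →L[ℂ] H)‖ + 1)) (by positivity)
  let L : Space d →L[ℝ] Space d := Λ.symm.toContinuousLinearEquiv
  -- The pulled-back partition then has mesh below δ; the + 1 here and in the choice of δ guards
  -- against a zero norm.
  refine ⟨δ / (‖L‖ + 1), by positivity, fun Δ t hp => ?_⟩
  have hp' := hp.preimage Λ (δ' := δ) fun x hx => by
    have h1 : ‖Λ.symm x‖ ≤ ‖L‖ * ‖x‖ := L.le_opNorm x
    rw [lt_div_iff₀ (by positivity)] at hx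
    nlinarith [norm_nonneg x, norm_nonneg L]
  obtain ⟨S, hsum, hn⟩ := hS _ _ hp'
  refine ⟨W S, ?_, ?_⟩
  · refine (congrArg (HasSum · (W S)) (funext fun i => ?_)).mpr (hsum.mapL (W : H →L[ℂ] H))
    have h2 := hE.intertwine hη_symm hη hΛ (W := (W : H →L[ℂ] H)) hW (hp.measurableSet i)
      (g (Λ.symm (t i)))
    refine Eq.trans ?_ h2.symm
    rw [ContinuousLinearEquiv.coe_coe, ← hg, LinearEquiv.apply_symm_apply]
  · rw [← map_sub]
    have h1 : ‖W (S - Φ)‖ ≤ ‖(W : H →L[ℂ] H)‖ * ‖S - Φ‖ := (W : H →L[ℂ] H).le_opNorm _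
    rw [lt_div_iff₀ (by positivity)] at hn
    nlinarith [norm_nonneg (S - Φ)]

/-- Covariance of warped convolutions under intertwiners. -/
theorem conj_warp (hη_symm : η.IsSymm) (hη : η.Nondegenerate)
    (hE : IsSpectralResolution η U E)
    (hU : ∀ Ψ : H, Continuous fun x : Space d => U (Multiplicative.ofAdd x) Ψ)
    (hΛ : ∀ x y, η (Λ x) (Λ y) = η x y)
    (hW : ∀ x Ψ, W (trans U x Ψ) = trans U (Λ x) (W Ψ)) {F : H →ₗ.[ℂ] H}
    (hF : IsSmoothOperator η U E F) (Q : Space d →ₗ[ℝ] Space d) :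
    conj W (warp U E Q F) =
      warp U E (Λ.toLinearMap ∘ₗ Q ∘ₗ Λ.symm.toLinearMap) (conj W F) := by
  have hF' := hF.conj_of_intertwine hη_symm hη hE hΛ hW
  have hd := hF.warp_domain hη hE hU Q
  have hd' := hF'.warp_domain hη hE hU (Λ.toLinearMap ∘ₗ Q ∘ₗ Λ.symm.toLinearMap)
  refine LinearPMap.ext ?_ ?_
  · ext Ψ
    rw [hd', mem_domain_conj, hd]
    constructor
    · intro h
      have := apply_mem_smoothVectors hW h
      rwa [ContinuousLinearEquiv.apply_symm_apply] at this
    · exact apply_mem_smoothVectors (W := W.symm) (Λ := Λ.symm) (symm_intertwine hW)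
  · intro Ψ h h'
    have h1 := hasIntegral_warp Q F ⟨W.symm Ψ, h⟩
    have h2 := hasIntegral_warp _ (conj W F) ⟨Ψ, h'⟩
    exact (h1.intertwine hη_symm hη hE hΛ hW (integrand_conj hW Q F Ψ)).unique h2

theorem IsSkew.conj {Q : Space d →ₗ[ℝ] Space d} (hQ : IsSkew η Q)
    (hΛ : ∀ x y, η (Λ x) (Λ y) = η x y) :
    IsSkew η (Λ.toLinearMap ∘ₗ Q ∘ₗ Λ.symm.toLinearMap) := by
  have h : ∀ p q, η q (Λ (Q (Λ.symm p))) = η (Λ.symm q) (Q (Λ.symm p)) := fun p q => by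
    rw [← hΛ (Λ.symm q), LinearEquiv.apply_symm_apply]
  intro p q
  simp only [LinearMap.comp_apply, LinearEquiv.coe_coe]
  rw [h, h, hQ]

/-- Translations commute, so moving one past (Λ, a) only replaces x by Λx. Applied to V, this is the
intertwining relation on which the covariance rests. -/
theorem Affine.mul_inl (L : Subgroup (Space d ≃ₗ[ℝ] Space d)) (lam : Affine L) (x : Space d) :
    lam * SemidirectProduct.inl (Multiplicative.ofAdd x) =
      SemidirectProduct.inl (Multiplicative.ofAdd ((lam.right : Space d ≃ₗ[ℝ] Space d) x)) *
        lam := by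
  refine SemidirectProduct.ext ?_ ?_
  · simp only [SemidirectProduct.mul_left, SemidirectProduct.left_inl,
      SemidirectProduct.right_inl, map_one, MulAut.one_apply]
    exact mul_comm _ _
  · simp

end Covariance

end WarpedConvolution

/-! ### Covariance of warped convolutions -/

open WarpedConvolution in
theorem lemma4 {d : ℕ} {H : Type*} [NormedAddCommGroup H] [InnerProductSpace ℂ H]
    [CompleteSpace H]
    -- the inner product on `ℝ^d`, possibly indefinite
    (η : LinearMap.BilinForm ℝ (Space d)) (hη_symm : η.IsSymm) (hη_nondeg : η.Nondegenerate)
    -- the strongly continuous unitary representation of `ℝ^d` and its spectral resolution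
    (U : Multiplicative (Space d) →* (H ≃ₗᵢ[ℂ] H))
    (hU : ∀ Ψ : H, Continuous fun x : Space d => U (Multiplicative.ofAdd x) Ψ)
    (E : PVM (Space d) H) (hE : IsSpectralResolution η U E)
    -- the group `ℒ` and the extension of `U` to `𝒫 = ℒ ⋉ ℝ^d`
    (L : Subgroup (Space d ≃ₗ[ℝ] Space d))
    (hL : ∀ Λ ∈ L, ∀ x y : Space d, η (Λ x) (Λ y) = η x y)
    (V : Affine L →* (H ≃L[ℂ] H))
    (hV : ∀ x : Space d, V (SemidirectProduct.inl (Multiplicative.ofAdd x)) = trans U x)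
    (Q : Space d →ₗ[ℝ] Space d) (hQ : IsSkew η Q)
    (F : H →ₗ.[ℂ] H) (hF : IsSmoothOperator η U E F)
    (lam : Affine L) (Λ : Space d ≃ₗ[ℝ] Space d) (hΛ : Λ = lam.right) :
    -- both sides are meaningful
    (warp U E Q F).domain = smoothVectors U ∧
    IsSmoothOperator η U E (conj (V lam) F) ∧
    IsSkew η (Λ.toLinearMap ∘ₗ Q ∘ₗ Λ.symm.toLinearMap) ∧
    -- they are the same operator
    conj (V lam) (warp U E Q F) =
      warp U E (Λ.toLinearMap ∘ₗ Q ∘ₗ Λ.symm.toLinearMap) (conj (V lam) F) := by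
  have hΛη : ∀ x y, η (Λ x) (Λ y) = η x y := hL Λ (hΛ ▸ lam.right.2)
  have hW : ∀ x Ψ, V lam (trans U x Ψ) = trans U (Λ x) (V lam Ψ) := fun x Ψ => by
    have h := congrArg V (Affine.mul_inl L lam x)
    rw [map_mul, map_mul, hV, hV, ← hΛ] at h
    exact congrArg (fun S : H ≃L[ℂ] H => S Ψ) h
  exact ⟨hF.warp_domain hη_nondeg hE hU Q,
    hF.conj_of_intertwine hη_symm hη_nondeg hE hΛη hW, hQ.conj hΛη,
    conj_warp hη_symm hη_nondeg hE hU hΛη hW hF Q⟩
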